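/- All matroids are finite. Let $M$ be a matroid on a set $E$ with $|E|=n$, rank function $r(\cdot)$, closure operator $\mathrm{cl}$, and rank $r=r(M)$. A set is cyclic if it is a union of circuits; the set $\mathcal{Z}(M)$ of cyclic flats of $M$, ordered by inclusion, is a lattice. A configuration of a matroid $M$ with no coloops is a triple $(L,s,\rho)$ where $L$ is a lattice isomorphic to $\mathcal{Z}(M)$ and $s,\rho$ are the functions on $L$ such that, under a fixed isomorphism, if $x\in L$ corresponds to $X\in\mathcal{Z}(M)$, then $s(x)=|X|$ and $\rho(x)=r(X)$. A flag of $M$ is a chain $\mathrm{cl}(\emptyset)=X_0\subset X_1\subset\cdots\subset X_r=E$ in which $X_j$ is a flat of rank $j$; its composition is $(|X_0|,|X_1-X_0|,\ldots,|X_r-X_{r-1}|)$. The catenary data of $M$ assigns to each finite sequence $a=(a_0,a_1,\ldots)$ of non-negative integers, of any length, the number $\nu(M;a)$ of flags of $M$ with that composition (it is $0$ on every sequence that is not the composition of a flag of $M$). The rank sequence of an ordering $\pi=(\pi(1),\ldots,\pi(n))$ of $E$ is the sequence $\underline{r}(\pi)=r_1r_2\cdots r_n$ of zeros and ones with $r_j=r(\{\pi(1),\ldots,\pi(j)\})-r(\{\pi(1),\ldots,\pi(j-1)\})$.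 The $\mathcal{G}$-invariant of $M$ is the formal linear combination $\mathcal{G}(M)=\sum_{\pi}[\underline{r}(\pi)]$, over a field of characteristic zero, of symbols $[\underline{r}]$, one for each finite sequence, where $\pi$ ranges over all $n!$ orderings of $E$. **Theorem.** For a matroid $M$ with no coloops, the catenary data of $M$, and so $\mathcal{G}(M)$, can be derived from (that is, is determined by) its configuration: if $M$ and $N$ are matroids with no coloops and some triple $(L,s,\rho)$ is a configuration of both $M$ and $N$, then $M$ and $N$ have the same catenary data, and $\mathcal{G}(M)=\mathcal{G}(N)$. -/

import Mathlib

namespace Matroid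

/-- The rank `r(X)` of a set `X`, as a natural number (all matroids below are finite). -/
noncomputable def natRk {α : Type*} (M : Matroid α) (X : Set α) : ℕ :=
  (M.eRk X).toNat

/-- The rank `r(M)` of a matroid, as a natural number. -/
noncomputable def natRank {α : Type*} (M : Matroid α) : ℕ :=
  M.natRk M.E

/-! ### Cyclic flats and the configuration -/

/-- A set is cyclic if it is a union of circuits. -/
def IsCyclic {α : Type*} (M : Matroid α) (X : Set α) : Prop :=
  ∃ S : Set (Set α), (∀ C ∈ S, M.IsCircuit C) ∧ X = ⋃₀ S

/-- The set `𝒵(M)` of cyclic flats of `M`, as a type ordered by inclusion. -/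
abbrev CyclicFlat {α : Type*} (M : Matroid α) : Type _ :=
  {X : Set α // M.IsFlat X ∧ M.IsCyclic X}

theorem isCyclic_iff {α : Type*} {M : Matroid α} {X : Set α} :
    M.IsCyclic X ↔ ∀ e ∈ X, ∃ C ⊆ X, M.IsCircuit C ∧ e ∈ C := by
  constructor
  · rintro ⟨S, hS, rfl⟩ e ⟨C, hC, he⟩
    exact ⟨C, Set.subset_sUnion_of_mem hC, hS C hC, he⟩
  · intro h
    refine ⟨{C | C ⊆ X ∧ M.IsCircuit C}, fun C hC => hC.2, ?_⟩
    ext e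
    constructor
    · intro he
      obtain ⟨C, hCX, hC, heC⟩ := h e he
      exact ⟨C, ⟨hCX, hC⟩, heC⟩
    · rintro ⟨C, hC, heC⟩
      exact hC.1 heC

theorem isCyclic_closure_union {α : Type*} {M : Matroid α} {X Y : Set α}
    (hX : M.IsCyclic X) (hY : M.IsCyclic Y) (hXE : X ⊆ M.E) (hYE : Y ⊆ M.E) :
    M.IsCyclic (M.closure (X ∪ Y)) := by
  rw [isCyclic_iff] at *
  have hsub : X ∪ Y ⊆ M.closure (X ∪ Y) := M.subset_closure _ (Set.union_subset hXE hYE)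
  intro e he
  by_cases heU : e ∈ X ∪ Y
  · rcases heU with h | h
    · obtain ⟨C, hCX, hC, heC⟩ := hX e h
      exact ⟨C, (hCX.trans Set.subset_union_left).trans hsub, hC, heC⟩
    · obtain ⟨C, hCX, hC, heC⟩ := hY e h
      exact ⟨C, (hCX.trans Set.subset_union_right).trans hsub, hC, heC⟩
  · obtain ⟨C, hCX, hC, heC⟩ := exists_isCircuit_of_mem_closure he heU
    exact ⟨C, hCX.trans (Set.insert_subset he hsub), hC, heC⟩

theorem isFlat_sUnion_circuits_inter {α : Type*} {M : Matroid α} {X Y : Set α}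
    (hX : M.IsFlat X) (hY : M.IsFlat Y) :
    M.IsFlat (⋃₀ {C | M.IsCircuit C ∧ C ⊆ X ∩ Y}) := by
  set K := ⋃₀ {C | M.IsCircuit C ∧ C ⊆ X ∩ Y} with hK
  have hKX : K ⊆ X := Set.sUnion_subset fun C hC => hC.2.trans Set.inter_subset_left
  have hKY : K ⊆ Y := Set.sUnion_subset fun C hC => hC.2.trans Set.inter_subset_right
  rw [isFlat_iff_closure_eq]
  refine subset_antisymm ?_ (M.subset_closure K (hKX.trans hX.subset_ground))
  intro e he
  by_contra heK
  obtain ⟨C, hCK, hC, heC⟩ := exists_isCircuit_of_mem_closure he heK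
  have heX : e ∈ X := hX.closure ▸ M.closure_subset_closure hKX he
  have heY : e ∈ Y := hY.closure ▸ M.closure_subset_closure hKY he
  exact heK ⟨C, ⟨hC, hCK.trans (Set.insert_subset ⟨heX, heY⟩ (Set.subset_inter hKX hKY))⟩, heC⟩

/-- The lattice of cyclic flats: the order is inclusion, the join of `X` and `Y` is the closure of
`X ∪ Y`, and their meet is the union of the circuits contained in `X ∩ Y`. -/
instance CyclicFlat.instLattice {α : Type*} (M : Matroid α) : Lattice (M.CyclicFlat) where
  sup X Y := ⟨M.closure (X.1 ∪ Y.1), M.isFlat_closure _,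
    isCyclic_closure_union X.2.2 Y.2.2 X.2.1.subset_ground Y.2.1.subset_ground⟩
  inf X Y := ⟨⋃₀ {C | M.IsCircuit C ∧ C ⊆ X.1 ∩ Y.1},
    isFlat_sUnion_circuits_inter X.2.1 Y.2.1, ⟨_, fun _ hC => hC.1, rfl⟩⟩
  le_sup_left X Y := Set.subset_union_left.trans
    (M.subset_closure (X.1 ∪ Y.1) (Set.union_subset X.2.1.subset_ground Y.2.1.subset_ground))
  le_sup_right X Y := Set.subset_union_right.trans
    (M.subset_closure (X.1 ∪ Y.1) (Set.union_subset X.2.1.subset_ground Y.2.1.subset_ground))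
  sup_le X Y Z hXZ hYZ := by
    have h := M.closure_subset_closure (Set.union_subset hXZ hYZ)
    rw [Z.2.1.closure] at h
    exact h
  inf_le_left X Y := Set.sUnion_subset fun _ hC => hC.2.trans Set.inter_subset_left
  inf_le_right X Y := Set.sUnion_subset fun _ hC => hC.2.trans Set.inter_subset_right
  le_inf X Y Z hXY hXZ := by
    intro e he
    obtain ⟨C, hCX, hC, heC⟩ := isCyclic_iff.1 X.2.2 e he
    exact ⟨C, ⟨hC, hCX.trans (Set.subset_inter hXY hXZ)⟩, heC⟩

/-- `(L, s, ρ)` is the configuration of `M`: there is a lattice isomorphism from `L` to the lattice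
of cyclic flats of `M`, and if `x` corresponds to the cyclic flat `X`, then `s x = |X|` and
`ρ x = r(X)`. -/
def IsConfiguration {α : Type*} (M : Matroid α) {L : Type*} [Lattice L] (s ρ : L → ℕ) : Prop :=
  ∃ e : L ≃o M.CyclicFlat, ∀ x : L, s x = (e x).1.ncard ∧ ρ x = M.natRk (e x).1

/-! ### Flags and catenary data -/

/-- A flag `cl(∅) = X₀ ⊂ X₁ ⊂ ⋯ ⊂ X_r = E`, where `r = r(M)` and `X_j` is a flat of rank `j`. -/
structure IsFlag {α : Type*} (M : Matroid α) (X : Fin (M.natRank + 1) → Set α) : Prop where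
  bot_eq : X 0 = M.closure ∅
  top_eq : X (Fin.last M.natRank) = M.E
  strictMono : StrictMono X
  isFlat : ∀ j, M.IsFlat (X j)
  natRk_eq : ∀ j, M.natRk (X j) = (j : ℕ)

/-- The composition `(|X₀|, |X₁ - X₀|, …, |X_r - X_{r-1}|)` of a chain of sets, as a list. -/
noncomputable def flagComp {α : Type*} {r : ℕ} (X : Fin (r + 1) → Set α) : List ℕ :=
  (X 0).ncard :: List.ofFn fun j : Fin r => (X j.succ \ X j.castSucc).ncard

/-- The catenary data of `M`: `M.catenaryData a` is the number `ν(M; a₀, a₁, …, a_r)` of flags of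
`M` whose composition is `a`. It is `0` unless `a` is an `(n, r)`-composition for `n = |E|` and
`r = r(M)`. -/
noncomputable def catenaryData {α : Type*} (M : Matroid α) (a : List ℕ) : ℕ :=
  {X : Fin (M.natRank + 1) → Set α | M.IsFlag X ∧ flagComp X = a}.ncard

/-! ### The `𝒢`-invariant -/

/-- The set of the first `j` elements of `E` in an ordering `π` of `E`. -/
def orderingPrefix {α : Type*} (M : Matroid α) (π : Fin M.E.ncard ≃ M.E) (j : ℕ) : Set α :=
  {x | ∃ i : Fin M.E.ncard, (i : ℕ) < j ∧ (π i : α) = x}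

/-- The rank sequence `r₁ r₂ … r_n` of an ordering `π` of `E`, a sequence of zeros and ones:
`r_j = r({π(1), …, π(j)}) - r({π(1), …, π(j-1)})`. -/
noncomputable def rankSequence {α : Type*} (M : Matroid α) (π : Fin M.E.ncard ≃ M.E) : List ℕ :=
  List.ofFn fun j : Fin M.E.ncard =>
    M.natRk (M.orderingPrefix π (j + 1)) - M.natRk (M.orderingPrefix π j)

/-- The `𝒢`-invariant `∑_π [r(π)]`, the sum over all orderings `π` of `E`, where `[w]` is the basis
vector indexed by the sequence `w`. All the `w` that occur are `(n, r)`-sequences, that is, they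
have `n = |E|` terms, `r = r(M)` of which are `1` and the others `0`. -/
noncomputable def gInvariant (K : Type*) [Field K] {α : Type*} (M : Matroid α) : List ℕ →₀ K :=
  ∑ᶠ π : Fin M.E.ncard ≃ M.E, Finsupp.single (M.rankSequence π) (1 : K)

end Matroid

namespace Matroid

/-! ### Ranks as natural numbers -/

section Rank

variable {α : Type*} {M : Matroid α} [M.Finite] {X Y : Set α} {e : α}

/-! Call the type of a flat F the pair formed by its cyclic part, which is a cyclic flat, and the
number of coloops of M|F. The type gives |F|, r(F) and the cyclic flats inside F. The heart of the
proof is that the type of F and the configuration also determine how many flats of each type lie in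
F.

For a cyclic flat Z ⊆ F, the sets B with Z ⊆ B ⊆ F have generating polynomial (1+x)^|F-Z|. Sorting
them by V = cl(cyclic part of B) turns this into ∑ span(Z,V)·indep(V,F) (`intervalPoly_eq_sum`). For
Z ≠ V, span(Z,V) has only terms of degree above r(V)-r(Z), and indep(Z,V) has none, so a
Kazhdan-Lusztig-Stanley argument recovers both factors on pairs of cyclic flats
(`eq_of_sum_mul_eq_of_coeff_eq_zero`). Inverting span then yields indep(Z,F) for every flat F.
Sorting instead by the cyclic part of cl(B) gives indep(Z,F) = ∑ basis(Z,V)·flat(V,F)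
(`indepPoly_eq_sum`). Here basis(Z,V) is the term of degree r(V)-r(Z) in indep(Z,V), so flat(V,F) is
recovered by a second inversion.

Hence flats of equal type contain equally many flats of each type, and induction matches the chains
ending at them, compositions included (`exists_flatChains_equiv`). Without coloops, E has the top of
L and 0 as its type in both matroids, which settles the catenary data. Each ordering of E determines
one flag, and its rank sequence depends only on which members of that flag contain each element. A
bijection of ground sets carrying a flag to one of equal composition therefore preserves rank
sequences (`exists_orderings_equiv`). -/

theorem cast_natRk (M : Matroid α) [M.Finite] (X : Set α) : (M.natRk X : ℕ∞) = M.eRk X :=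
  ENat.natCast_toNat (eRk_ne_top_iff.2 (M.isRkFinite_set X))

theorem natRk_closure (M : Matroid α) (X : Set α) : M.natRk (M.closure X) = M.natRk X := by
  simp [natRk]

theorem natRk_mono (M : Matroid α) [M.Finite] (h : X ⊆ Y) : M.natRk X ≤ M.natRk Y := by
  have := M.eRk_mono h
  rw [← cast_natRk, ← cast_natRk] at this
  exact_mod_cast this

theorem natRk_insert_of_notMem_closure (he : e ∈ M.E) (heX : e ∉ M.closure X) :
    M.natRk (insert e X) = M.natRk X + 1 := by
  have := eRk_insert_eq_add_one (M := M) (X := X) ⟨he, heX⟩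
  rw [← cast_natRk, ← cast_natRk] at this
  exact_mod_cast this

theorem natRk_insert_le (M : Matroid α) [M.Finite] (e : α) (X : Set α) :
    M.natRk (insert e X) ≤ M.natRk X + 1 := by
  have := M.eRk_insert_le_add_one e X
  rw [← cast_natRk, ← cast_natRk] at this
  exact_mod_cast this

theorem natRk_union_le_add_ncard (M : Matroid α) [M.Finite] (hY : Y ⊆ M.E) :
    M.natRk (X ∪ Y) ≤ M.natRk X + Y.ncard := by
  have := M.eRk_union_le_eRk_add_encard X Y
  rw [← cast_natRk, ← cast_natRk, ← (M.ground_finite.subset hY).cast_ncard_eq] at this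
  exact_mod_cast this

theorem closure_eq_closure_of_natRk_le (hXY : X ⊆ Y) (h : M.natRk Y ≤ M.natRk X) :
    M.closure X = M.closure Y := by
  refine (M.isRkFinite_set X).closure_eq_closure_of_subset_of_eRk_ge_eRk hXY ?_
  rw [← cast_natRk, ← cast_natRk]
  exact_mod_cast h

theorem IsFlat.eq_of_natRk_le (hX : M.IsFlat X) (hY : M.IsFlat Y) (hXY : X ⊆ Y)
    (h : M.natRk Y ≤ M.natRk X) : X = Y := by
  rw [← hX.closure, ← hY.closure, closure_eq_closure_of_natRk_le hXY h]

theorem ncard_add_ncard_sdiff (M : Matroid α) [M.Finite] (hXY : X ⊆ Y) (hY : Y ⊆ M.E) :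
    X.ncard + (Y \ X).ncard = Y.ncard := by
  rw [add_comm]
  exact Set.ncard_sdiff_add_ncard_of_subset hXY (M.ground_finite.subset hY)

end Rank

/-! ### The cyclic part of a set -/

section CyclicPart

variable {α : Type*} {M : Matroid α} {X Y Z V F : Set α} {e : α}

/-- The largest cyclic subset of `X`: the union of the circuits contained in `X`. -/
def cyclicPart (M : Matroid α) (X : Set α) : Set α :=
  ⋃₀ {C | M.IsCircuit C ∧ C ⊆ X}

theorem cyclicPart_subset (M : Matroid α) (X : Set α) : M.cyclicPart X ⊆ X :=
  Set.sUnion_subset fun _ hC => hC.2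

theorem IsCircuit.subset_cyclicPart {C : Set α} (hC : M.IsCircuit C) (h : C ⊆ X) :
    C ⊆ M.cyclicPart X :=
  Set.subset_sUnion_of_mem (show C ∈ {C | M.IsCircuit C ∧ C ⊆ X} from ⟨hC, h⟩)

theorem cyclicPart_mono (M : Matroid α) (h : X ⊆ Y) : M.cyclicPart X ⊆ M.cyclicPart Y :=
  Set.sUnion_subset fun _ hC => hC.1.subset_cyclicPart (hC.2.trans h)

theorem isCyclic_cyclicPart (M : Matroid α) (X : Set α) : M.IsCyclic (M.cyclicPart X) :=
  ⟨_, fun _ hC => hC.1, rfl⟩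

theorem IsCyclic.subset_cyclicPart (hX : M.IsCyclic X) (h : X ⊆ Y) : X ⊆ M.cyclicPart Y := by
  intro e he
  obtain ⟨C, hCX, hC, heC⟩ := isCyclic_iff.1 hX e he
  exact hC.subset_cyclicPart (hCX.trans h) heC

theorem IsCyclic.cyclicPart_eq (hX : M.IsCyclic X) : M.cyclicPart X = X :=
  (M.cyclicPart_subset X).antisymm (hX.subset_cyclicPart subset_rfl)

theorem cyclicPart_cyclicPart (M : Matroid α) (X : Set α) :
    M.cyclicPart (M.cyclicPart X) = M.cyclicPart X :=
  (M.isCyclic_cyclicPart X).cyclicPart_eq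

theorem IsFlat.cyclicPart (hF : M.IsFlat F) : M.IsFlat (M.cyclicPart F) := by
  have := isFlat_sUnion_circuits_inter hF hF
  rwa [Set.inter_self] at this

theorem IsCyclic.closure (hX : M.IsCyclic X) (hXE : X ⊆ M.E) : M.IsCyclic (M.closure X) := by
  have := isCyclic_closure_union hX hX hXE hXE
  rwa [Set.union_self] at this

/-- An element outside the cyclic part of `X` is a coloop of the restriction to `X`. -/
theorem notMem_closure_of_notMem_cyclicPart (heX : e ∈ X) (he : e ∉ M.cyclicPart X)
    (hYX : Y ⊆ X) (heY : e ∉ Y) : e ∉ M.closure Y := by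
  intro h
  obtain ⟨C, hCY, hC, heC⟩ := exists_isCircuit_of_mem_closure h heY
  exact he (hC.subset_cyclicPart (hCY.trans (Set.insert_subset heX hYX)) heC)

theorem IsFlat.subset_cyclicPart_iff (hV : M.IsFlat V ∧ M.IsCyclic V) :
    V ⊆ M.cyclicPart F ↔ V ⊆ F :=
  ⟨fun h => h.trans (M.cyclicPart_subset F), fun h => hV.2.subset_cyclicPart h⟩

/-- The elements of `D` are coloops of the restriction to `X`, so adding them one at a time raises
the rank each time. -/
theorem natRk_cyclicPart_union [M.Finite] (hX : X ⊆ M.E) {D : Set α}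
    (hD : D ⊆ X \ M.cyclicPart X) :
    M.natRk (M.cyclicPart X ∪ D) = M.natRk (M.cyclicPart X) + D.ncard := by
  have hfin : D.Finite := M.ground_finite.subset (hD.trans (Set.sdiff_subset.trans hX))
  induction D, hfin using Set.Finite.induction_on with
  | empty => simp
  | @insert a D haD hfin ih =>
    rw [Set.insert_subset_iff] at hD
    rw [Set.union_insert, natRk_insert_of_notMem_closure (hX hD.1.1), ih hD.2,
      Set.ncard_insert_of_notMem haD hfin, add_assoc]
    refine notMem_closure_of_notMem_cyclicPart hD.1.1 hD.1.2
      (Set.union_subset (M.cyclicPart_subset X) (hD.2.trans Set.sdiff_subset)) ?_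
    rintro (h | h)
    · exact hD.1.2 h
    · exact haD h

theorem natRk_eq_natRk_cyclicPart_add [M.Finite] (hX : X ⊆ M.E) :
    M.natRk X = M.natRk (M.cyclicPart X) + (X \ M.cyclicPart X).ncard := by
  rw [← natRk_cyclicPart_union hX subset_rfl, Set.union_sdiff_cancel (M.cyclicPart_subset X)]

/-- The cyclic part of a flat, as a cyclic flat. -/
def IsFlat.cyclicFlat (hF : M.IsFlat F) : M.CyclicFlat :=
  ⟨M.cyclicPart F, hF.cyclicPart, M.isCyclic_cyclicPart F⟩

/-! The two decompositions of sets along a cyclic flat. -/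

/-- Suppose a circuit on the left contains some `e` outside the closure. Then `e` is a coloop of the
restriction to `X`, yet the rest of the circuit lies in the closure of `X \ {e}`, which is
impossible. -/
theorem cyclicPart_union_closure_cyclicPart (hX : X ⊆ M.E) :
    M.cyclicPart (X ∪ M.closure (M.cyclicPart X)) = M.closure (M.cyclicPart X) := by
  have hcE : M.cyclicPart X ⊆ M.E := (M.cyclicPart_subset X).trans hX
  refine subset_antisymm (Set.sUnion_subset ?_) (((M.isCyclic_cyclicPart X).closure hcE).subset_cyclicPart
    Set.subset_union_right)
  rintro C ⟨hC, hCX⟩ e heC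
  by_contra he
  have heX : e ∈ X := (hCX heC).resolve_right he
  have hec : e ∉ M.cyclicPart X := fun h => he (M.subset_closure _ hcE h)
  have h1 : e ∉ M.closure (X \ {e}) :=
    notMem_closure_of_notMem_cyclicPart heX hec Set.sdiff_subset (by simp)
  apply h1
  have h2 : C \ {e} ⊆ M.closure (X \ {e}) := by
    rintro x ⟨hxC, hxe⟩
    rcases hCX hxC with hx | hx
    · exact M.subset_closure _ (Set.sdiff_subset.trans hX) ⟨hx, hxe⟩
    · refine M.closure_subset_closure ?_ hx
      exact fun y hy => ⟨M.cyclicPart_subset X hy, fun h => hec (h ▸ hy)⟩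
  have := M.closure_subset_closure h2 (hC.mem_closure_sdiff_singleton_of_mem heC)
  rwa [closure_closure] at this

theorem inter_closure_cyclicPart (hX : X ⊆ M.E) :
    X ∩ M.closure (M.cyclicPart X) = M.cyclicPart X := by
  refine subset_antisymm ?_ (Set.subset_inter (M.cyclicPart_subset X)
    (M.subset_closure _ ((M.cyclicPart_subset X).trans hX)))
  rintro e ⟨heX, he⟩
  by_contra hec
  exact notMem_closure_of_notMem_cyclicPart heX hec (M.cyclicPart_subset X) hec he

/-- A spanning set of a restriction contains all its coloops. -/
theorem sdiff_cyclicPart_closure_subset (hX : X ⊆ M.E) :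
    M.closure X \ M.cyclicPart (M.closure X) ⊆ X := by
  rintro e ⟨he, hec⟩
  by_contra heX
  exact notMem_closure_of_notMem_cyclicPart he hec (M.subset_closure X hX) heX he

theorem closure_inter_cyclicPart_closure (hX : X ⊆ M.E) :
    M.closure (X ∩ M.cyclicPart (M.closure X)) = M.cyclicPart (M.closure X) := by
  have hfl : M.IsFlat (M.cyclicPart (M.closure X)) := (M.isFlat_closure X).cyclicPart
  refine subset_antisymm ?_ ?_
  · rw [hfl.closure.symm]
    refine M.closure_subset_closure ?_
    rw [hfl.closure]
    exact Set.inter_subset_right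
  · intro e he
    by_cases heX : e ∈ X
    · exact M.subset_closure _ (Set.inter_subset_left.trans hX) ⟨heX, he⟩
    -- The circuit joining `e` to `X` lies in the cyclic part of the closure, so the rest of it
    -- already lies in the intersection and spans `e`.
    · obtain ⟨C, hCX, hC, heC⟩ := exists_isCircuit_of_mem_closure (M.cyclicPart_subset _ he) heX
      refine M.closure_subset_closure ?_ (hC.mem_closure_sdiff_singleton_of_mem heC)
      rintro x ⟨hxC, hxe⟩
      exact ⟨(hCX hxC).resolve_left hxe, hC.subset_cyclicPart
        (hCX.trans (Set.insert_subset (M.cyclicPart_subset _ he) (M.subset_closure X hX))) hxC⟩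

theorem cyclicPart_inter_cyclicPart_closure (hX : X ⊆ M.E) :
    M.cyclicPart (X ∩ M.cyclicPart (M.closure X)) = M.cyclicPart X :=
  subset_antisymm (M.cyclicPart_mono Set.inter_subset_left)
    ((M.isCyclic_cyclicPart X).subset_cyclicPart (Set.subset_inter (M.cyclicPart_subset X)
      (M.cyclicPart_mono (M.subset_closure X hX))))

/-- No circuit inside `F` meets `F \ V`, since `V` is the cyclic part of `F`. -/
theorem cyclicPart_union_sdiff (hF : M.cyclicPart F = V) (hXV : X ⊆ V) :
    M.cyclicPart (X ∪ (F \ V)) = M.cyclicPart X := by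
  have hVF : V ⊆ F := hF ▸ M.cyclicPart_subset F
  refine subset_antisymm (Set.sUnion_subset ?_) (M.cyclicPart_mono Set.subset_union_left)
  rintro C ⟨hC, hCX⟩
  refine hC.subset_cyclicPart fun e heC => (hCX heC).resolve_right fun h => h.2 ?_
  rw [← hF]
  exact hC.subset_cyclicPart (hCX.trans (Set.union_subset (hXV.trans hVF) Set.sdiff_subset)) heC

theorem closure_union_sdiff_of_closure_eq (hF : M.IsFlat F) (hVF : V ⊆ F) (hX : M.closure X = V) :
    M.closure (X ∪ (F \ V)) = F := by
  rw [← closure_union_closure_left_eq, hX, Set.union_sdiff_cancel hVF, hF.closure]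

end CyclicPart

end Matroid

namespace Matroid

open Polynomial
open scoped Classical

/-! ### Generating polynomials -/

section Polynomials

variable {α : Type*} (M : Matroid α) [M.Finite] {A Z V F : Set α}

/-- The subsets of the ground set with property `p`. -/
noncomputable def groundSets (p : Set α → Prop) : Finset (Set α) :=
  (M.ground_finite.finite_subsets.subset fun _ hB => hB.1 : {B | B ⊆ M.E ∧ p B}.Finite).toFinset

variable {M} in
@[simp]
theorem mem_groundSets {p : Set α → Prop} : A ∈ M.groundSets p ↔ A ⊆ M.E ∧ p A := by
  simp [groundSets]

/-- The sum of `x ^ |B \ Z|` over the sets `B` with property `p`. -/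
noncomputable def sizePoly (p : Set α → Prop) (Z : Set α) : ℤ[X] :=
  ∑ B ∈ M.groundSets p, X ^ (B \ Z).ncard

theorem coeff_sizePoly (p : Set α → Prop) (Z : Set α) (k : ℕ) :
    (M.sizePoly p Z).coeff k = ((M.groundSets fun B => p B ∧ (B \ Z).ncard = k).card : ℤ) := by
  have : (M.groundSets fun B => p B ∧ (B \ Z).ncard = k) =
      (M.groundSets p).filter fun B => k = (B \ Z).ncard := by
    ext B
    simp [and_assoc, eq_comm]
  simp only [sizePoly, finsetSum_coeff, coeff_X_pow, Finset.sum_boole, this]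

theorem sizePoly_eq_zero {p : Set α → Prop} (h : ∀ B ⊆ M.E, ¬ p B) (Z : Set α) :
    M.sizePoly p Z = 0 :=
  Finset.sum_eq_zero fun B hB => absurd (mem_groundSets.1 hB).2 (h B (mem_groundSets.1 hB).1)

theorem sizePoly_eq_one {p : Set α → Prop} {Z : Set α} (hZ : Z ⊆ M.E)
    (h : ∀ B ⊆ M.E, p B ↔ B = Z) : M.sizePoly p Z = 1 := by
  have : M.groundSets p = {Z} := by
    ext B
    simp only [mem_groundSets, Finset.mem_singleton]
    exact ⟨fun hB => (h B hB.1).1 hB.2, fun hB => hB ▸ ⟨hZ, (h Z hZ).2 rfl⟩⟩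
  simp [sizePoly, this]

/-- Counts the sets between `Z` and `F`. -/
noncomputable def intervalPoly (Z F : Set α) : ℤ[X] :=
  M.sizePoly (fun B => Z ⊆ B ∧ B ⊆ F) Z

/-- Counts the cyclic spanning sets of `M | V` that contain `Z`. -/
noncomputable def spanPoly (Z V : Set α) : ℤ[X] :=
  M.sizePoly (fun B => Z ⊆ B ∧ M.cyclicPart B = B ∧ M.closure B = V) Z

/-- Counts the subsets of `F` with cyclic part `Z`. If `Z` is a cyclic flat, these correspond to
the independent sets of `(M | F) / Z`. -/
noncomputable def indepPoly (Z F : Set α) : ℤ[X] :=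
  M.sizePoly (fun B => B ⊆ F ∧ M.cyclicPart B = Z) Z

/-- Counts the spanning sets of `M | V` with cyclic part `Z`. If `Z` is a cyclic flat, these
correspond to the bases of `(M | V) / Z`. -/
noncomputable def basisPoly (Z V : Set α) : ℤ[X] :=
  M.sizePoly (fun B => M.closure B = V ∧ M.cyclicPart B = Z) Z

/-- Counts the flats contained in `F` with cyclic part `V`. -/
noncomputable def flatPoly (V F : Set α) : ℤ[X] :=
  M.sizePoly (fun B => (M.IsFlat B ∧ B ⊆ F) ∧ M.cyclicPart B = V) V

/-- What matters is that the right side depends on `|F \ Z|` alone. -/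
theorem intervalPoly_of_subset (hZF : Z ⊆ F) (hF : F ⊆ M.E) :
    M.intervalPoly Z F = ∑ m ∈ Finset.range ((F \ Z).ncard + 1),
      (F \ Z).ncard.choose m • (X : ℤ[X]) ^ m := by
  have hfin : (F \ Z).Finite := M.ground_finite.subset (Set.sdiff_subset.trans hF)
  rw [Set.ncard_eq_toFinset_card _ hfin, ← Finset.sum_powerset_apply_card, intervalPoly, sizePoly]
  have hsub : ∀ B, B ⊆ F → (B \ Z).Finite := fun B hB =>
    hfin.subset (Set.sdiff_subset_sdiff_left hB)
  refine Finset.sum_bij' (i := fun B hB => (hsub B (mem_groundSets.1 hB).2.2).toFinset)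
    (j := fun D _ => Z ∪ ↑D) ?_ ?_ ?_ ?_ ?_
  · intro B hB
    simp only [mem_groundSets] at hB
    rw [Finset.mem_powerset, Set.Finite.toFinset_subset_toFinset]
    exact Set.sdiff_subset_sdiff_left hB.2.2
  · intro D hD
    simp only [Finset.mem_powerset, Finset.subset_iff, Set.Finite.mem_toFinset] at hD
    have : Z ∪ ↑D ⊆ F := Set.union_subset hZF fun x hx => (hD hx).1
    simp only [mem_groundSets]
    exact ⟨this.trans hF, Set.subset_union_left, this⟩
  · intro B hB
    simp only [mem_groundSets] at hB
    simp [hB.2.1]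
  · intro D hD
    simp only [Finset.mem_powerset, Finset.subset_iff, Set.Finite.mem_toFinset] at hD
    ext x
    simp only [Set.Finite.mem_toFinset, Set.mem_sdiff, Set.mem_union, Finset.mem_coe]
    exact ⟨fun h => h.1.resolve_left h.2, fun h => ⟨Or.inr h, (hD h).2⟩⟩
  · intro B hB
    rw [Set.ncard_eq_toFinset_card _ (hsub B (mem_groundSets.1 hB).2.2)]

instance : Finite M.CyclicFlat :=
  Set.Finite.to_subtype (M.ground_finite.finite_subsets.subset fun _ hX => hX.1.subset_ground)

noncomputable instance : Fintype M.CyclicFlat := Fintype.ofFinite _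

variable {M}

/-- Sort the sets `B` with property `p` by a cyclic flat `g B`: if those with `g B = V` correspond
to the pairs of sets `C`, `D` with properties `q V C` and `t V D` via `B = C ∪ (D \ V)`, then the
generating polynomial factors. -/
theorem sizePoly_eq_sum_mul {p : Set α → Prop} {q t : Set α → Set α → Prop}
    (g : Set α → Set α) (hg : ∀ B ⊆ M.E, p B → M.IsFlat (g B) ∧ M.IsCyclic (g B))
    (h₁ : ∀ B ⊆ M.E, p B → q (g B) (B ∩ g B) ∧ t (g B) (B ∪ g B))
    (hq : ∀ V C, C ⊆ M.E → q V C → Z ⊆ V ∧ C ⊆ V) (ht : ∀ V D, t V D → V ⊆ D)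
    (h₂ : ∀ V C D, M.IsFlat V → M.IsCyclic V → C ⊆ M.E → D ⊆ M.E → q V C → t V D →
      p (C ∪ (D \ V)) ∧ g (C ∪ (D \ V)) = V) :
    M.sizePoly p Z = ∑ V : M.CyclicFlat, M.sizePoly (q V) Z * M.sizePoly (t V) V := by
  have key : ∀ B ∈ M.groundSets p,
      (∃ V : M.CyclicFlat, g B = V.1) := fun B hB => by
    rw [mem_groundSets] at hB
    exact ⟨⟨g B, hg B hB.1 hB.2⟩, rfl⟩
  have : M.sizePoly p Z = ∑ V : M.CyclicFlat,
      ∑ B ∈ (M.groundSets p).filter (g · = V.1), (X : ℤ[X]) ^ (B \ Z).ncard := by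
    rw [Finset.sum_comm' (t' := M.groundSets p)
      (s' := fun B => Finset.univ.filter fun V : M.CyclicFlat => g B = V.1) (by simp [and_comm])]
    refine Finset.sum_congr rfl fun B hB => ?_
    obtain ⟨V, hV⟩ := key B hB
    -- Each `B` is counted for exactly one cyclic flat, namely `g B`.
    have : (Finset.univ.filter fun V : M.CyclicFlat => g B = V.1) = {V} := by
      ext W
      simp [hV, Subtype.ext_iff, eq_comm]
    rw [this, Finset.sum_singleton]
  rw [this]
  refine Finset.sum_congr rfl fun V _ => ?_
  rw [sizePoly, sizePoly, Finset.sum_mul_sum, ← Finset.sum_product']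
  symm
  refine Finset.sum_nbij' (fun P => P.1 ∪ (P.2 \ V)) (fun B => (B ∩ V, B ∪ V)) ?_ ?_ ?_ ?_ ?_
  · rintro ⟨C, D⟩ hP
    simp only [Finset.mem_product, Finset.mem_filter, mem_groundSets] at hP ⊢
    obtain ⟨⟨hC, hqC⟩, hD, htD⟩ := hP
    obtain ⟨h, h'⟩ := h₂ V C D V.2.1 V.2.2 hC hD hqC htD
    exact ⟨⟨Set.union_subset hC (Set.sdiff_subset.trans hD), h⟩, h'⟩
  · intro B hB
    simp only [Finset.mem_product, Finset.mem_filter, mem_groundSets] at hB ⊢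
    obtain ⟨⟨hBE, hpB⟩, hgB⟩ := hB
    obtain ⟨h, h'⟩ := h₁ B hBE hpB
    rw [hgB] at h h'
    exact ⟨⟨Set.inter_subset_left.trans hBE, h⟩, Set.union_subset hBE V.2.1.subset_ground, h'⟩
  · rintro ⟨C, D⟩ hP
    simp only [Finset.mem_product, mem_groundSets] at hP
    have hC := (hq _ _ hP.1.1 hP.1.2).2
    have hD := ht _ _ hP.2.2
    ext x
    · have := @hC x
      simp
      tauto
    · have := @hC x
      have := @hD x
      simp
      tauto
  · intro B hB
    ext x
    simp
  · rintro ⟨C, D⟩ hP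
    simp only [Finset.mem_product, mem_groundSets] at hP
    obtain ⟨⟨hC, hqC⟩, hD, htD⟩ := hP
    obtain ⟨hZV, hCV⟩ := hq _ _ hC hqC
    -- Since `Z` and `C` are contained in `V`, the two pieces are disjoint and the exponents add.
    have : (C ∪ (D \ V)) \ Z = (C \ Z) ∪ (D \ V) := by
      ext x
      have := @hZV x
      simp
      tauto
    rw [← pow_add, this, Set.ncard_union_eq _ (M.ground_finite.subset (Set.sdiff_subset.trans hC))
      (M.ground_finite.subset (Set.sdiff_subset.trans hD))]
    exact Set.disjoint_left.2 fun x hx hx' => hx'.2 (hCV hx.1)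

/-- With `V` the closure of the cyclic part of `B`, the set `B ∩ V` is the cyclic part of `B`, and
`B ∪ V` adds to `V` only coloops. -/
theorem intervalPoly_eq_sum (hZ : M.IsCyclic Z) (hF : M.IsFlat F) :
    M.intervalPoly Z F = ∑ V : M.CyclicFlat, M.spanPoly Z V * M.indepPoly V F := by
  refine sizePoly_eq_sum_mul (q := fun V B => Z ⊆ B ∧ M.cyclicPart B = B ∧ M.closure B = V)
    (t := fun V B => B ⊆ F ∧ M.cyclicPart B = V) (fun B => M.closure (M.cyclicPart B)) ?_ ?_ ?_ ?_ ?_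
  · exact fun B hB _ => ⟨M.isFlat_closure _,
      (M.isCyclic_cyclicPart B).closure ((M.cyclicPart_subset B).trans hB)⟩
  · rintro B hB ⟨hZB, hBF⟩
    rw [inter_closure_cyclicPart hB, cyclicPart_union_closure_cyclicPart hB]
    refine ⟨⟨hZ.subset_cyclicPart hZB, M.cyclicPart_cyclicPart B, rfl⟩,
      Set.union_subset hBF ?_, rfl⟩
    rw [← hF.closure]
    exact M.closure_subset_closure ((M.cyclicPart_subset B).trans hBF)
  · rintro V C hC ⟨hZC, -, rfl⟩
    exact ⟨hZC.trans (M.subset_closure C hC), M.subset_closure C hC⟩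
  · rintro V D ⟨-, rfl⟩
    exact M.cyclicPart_subset D
  · rintro V C D hV - hCE hDE ⟨hZC, hC, hCV⟩ ⟨hDF, hDV⟩
    have hCV' : C ⊆ V := hCV ▸ M.subset_closure C hCE
    have hVD : V ⊆ D := hDV ▸ M.cyclicPart_subset D
    refine ⟨⟨hZC.trans Set.subset_union_left, Set.union_subset (hCV'.trans (hVD.trans hDF))
      (Set.sdiff_subset.trans hDF)⟩, ?_⟩
    rw [cyclicPart_union_sdiff hDV hCV', hC, hCV]

/-- With `V` the cyclic part of the closure of `B`, the set `B ∩ V` spans `V`, and `B ∪ V` is the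
closure of `B`, because `B` contains all coloops of the restriction to its closure. -/
theorem indepPoly_eq_sum (hF : M.IsFlat F) :
    M.indepPoly Z F = ∑ V : M.CyclicFlat, M.basisPoly Z V * M.flatPoly V F := by
  refine sizePoly_eq_sum_mul (q := fun V B => M.closure B = V ∧ M.cyclicPart B = Z)
    (t := fun V B => (M.IsFlat B ∧ B ⊆ F) ∧ M.cyclicPart B = V)
    (fun B => M.cyclicPart (M.closure B)) ?_ ?_ ?_ ?_ ?_
  · exact fun B _ _ => ⟨(M.isFlat_closure B).cyclicPart, M.isCyclic_cyclicPart _⟩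
  · rintro B hB ⟨hBF, hBZ⟩
    have : B ∪ M.cyclicPart (M.closure B) = M.closure B :=
      (Set.union_subset (M.subset_closure B hB) (M.cyclicPart_subset _)).antisymm fun x hx => by
        by_cases h : x ∈ M.cyclicPart (M.closure B)
        · exact Or.inr h
        · exact Or.inl (sdiff_cyclicPart_closure_subset hB ⟨hx, h⟩)
    rw [this]
    refine ⟨⟨closure_inter_cyclicPart_closure hB, ?_⟩, ⟨M.isFlat_closure B, ?_⟩, rfl⟩
    · rw [cyclicPart_inter_cyclicPart_closure hB, hBZ]
    · rw [← hF.closure]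
      exact M.closure_subset_closure hBF
  · rintro V C hC ⟨rfl, rfl⟩
    exact ⟨(M.cyclicPart_subset C).trans (M.subset_closure C hC), M.subset_closure C hC⟩
  · rintro V D ⟨-, rfl⟩
    exact M.cyclicPart_subset D
  · rintro V C D hV - hCE hDE ⟨hCV, hCZ⟩ ⟨⟨hD, hDF⟩, hDV⟩
    have hCV' : C ⊆ V := hCV ▸ M.subset_closure C hCE
    have hVD : V ⊆ D := hDV ▸ M.cyclicPart_subset D
    refine ⟨⟨Set.union_subset (hCV'.trans (hVD.trans hDF)) (Set.sdiff_subset.trans hDF), ?_⟩, ?_⟩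
    · rw [cyclicPart_union_sdiff hDV hCV', hCZ]
    · rw [closure_union_sdiff_of_closure_eq hD hVD hCV, hDV]

end Polynomials

end Matroid

namespace Matroid

open Polynomial
open scoped Classical

/-! ### Unitriangularity and degree bounds of the counting polynomials -/

section Coefficients

variable {α : Type*} {M : Matroid α} [M.Finite] {A Z V F : Set α} {k : ℕ}

theorem spanPoly_eq_zero (h : ¬ Z ⊆ V) : M.spanPoly Z V = 0 := by
  refine sizePoly_eq_zero M ?_ Z
  rintro B hB ⟨hZB, -, rfl⟩
  exact h (hZB.trans (M.subset_closure B hB))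

theorem spanPoly_self (hZ : M.IsFlat Z) (hZ' : M.IsCyclic Z) : M.spanPoly Z Z = 1 := by
  refine sizePoly_eq_one M hZ.subset_ground fun B hB => ⟨?_, ?_⟩
  · rintro ⟨hZB, -, hBZ⟩
    exact ((M.subset_closure B hB).trans hBZ.subset).antisymm hZB
  · rintro rfl
    exact ⟨subset_rfl, hZ'.cyclicPart_eq, hZ.closure⟩

theorem indepPoly_eq_zero (h : ¬ Z ⊆ F) : M.indepPoly Z F = 0 := by
  refine sizePoly_eq_zero M ?_ Z
  rintro B hB ⟨hBF, rfl⟩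
  exact h ((M.cyclicPart_subset B).trans hBF)

theorem indepPoly_self (hZ : M.IsCyclic Z) (hZE : Z ⊆ M.E) : M.indepPoly Z Z = 1 := by
  refine sizePoly_eq_one M hZE fun B hB => ⟨?_, ?_⟩
  · rintro ⟨hBZ, hB'⟩
    exact hBZ.antisymm (hB'.symm.subset.trans (M.cyclicPart_subset B))
  · rintro rfl
    exact ⟨subset_rfl, hZ.cyclicPart_eq⟩

theorem basisPoly_eq_zero (h : ¬ Z ⊆ V) : M.basisPoly Z V = 0 := by
  refine sizePoly_eq_zero M ?_ Z
  rintro B hB ⟨rfl, rfl⟩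
  exact h ((M.cyclicPart_subset B).trans (M.subset_closure B hB))

theorem basisPoly_self (hZ : M.IsFlat Z) (hZ' : M.IsCyclic Z) : M.basisPoly Z Z = 1 := by
  refine sizePoly_eq_one M hZ.subset_ground fun B hB => ⟨?_, ?_⟩
  · rintro ⟨hBZ, hB'⟩
    exact ((M.subset_closure B hB).trans hBZ.subset).antisymm
      (hB'.symm.subset.trans (M.cyclicPart_subset B))
  · rintro rfl
    exact ⟨hZ.closure, hZ'.cyclicPart_eq⟩

theorem intervalPoly_eq_zero (h : ¬ Z ⊆ F) : M.intervalPoly Z F = 0 :=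
  sizePoly_eq_zero M (fun _ _ hp => h (hp.1.trans hp.2)) Z

theorem coeff_sizePoly_eq_zero {p : Set α → Prop}
    (h : ∀ B ⊆ M.E, p B → (B \ Z).ncard ≠ k) : (M.sizePoly p Z).coeff k = 0 := by
  rw [coeff_sizePoly, Nat.cast_eq_zero, Finset.card_eq_zero, Finset.eq_empty_iff_forall_notMem]
  intro B hB
  rw [mem_groundSets] at hB
  exact h B hB.1 hB.2.1 hB.2.2

/-- A set `B` with cyclic part `Z` has rank `r(Z) + |B \ Z|`, which cannot exceed `r(F)`. -/
theorem coeff_indepPoly_eq_zero (h : M.natRk F < M.natRk Z + k) :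
    (M.indepPoly Z F).coeff k = 0 := by
  refine coeff_sizePoly_eq_zero ?_
  rintro B hB ⟨hBF, rfl⟩ rfl
  rw [← natRk_eq_natRk_cyclicPart_add hB] at h
  exact h.not_ge (M.natRk_mono hBF)

/-- A counted `B` properly contains `Z`, since `Z` is a flat other than `V`. As `B` is cyclic, some
`e ∈ B \ Z` can be deleted without lowering the rank, so `r(V) ≤ r(Z) + |B \ Z| - 1`. -/
theorem coeff_spanPoly_eq_zero (hZ : M.IsFlat Z) (hZV : Z ≠ V) (h : M.natRk Z + k ≤ M.natRk V) :
    (M.spanPoly Z V).coeff k = 0 := by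
  refine coeff_sizePoly_eq_zero ?_
  rintro B hB ⟨hZB, hBc, rfl⟩ rfl
  obtain ⟨e, heB, heZ⟩ : ∃ e ∈ B, e ∉ Z := by
    by_contra! hcon
    exact hZV (by rw [hZB.antisymm hcon, ← hZB.antisymm hcon, hZ.closure])
  have heB' : e ∈ M.cyclicPart B := hBc.symm ▸ heB
  obtain ⟨C, ⟨hC, hCB⟩, heC⟩ := heB'
  have h1 : M.closure (B \ {e}) = M.closure B :=
    (mem_closure_sdiff_singleton_iff_closure heB (hB heB)).1
      (M.closure_subset_closure (Set.sdiff_subset_sdiff_left hCB)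
        (hC.mem_closure_sdiff_singleton_of_mem heC))
  have h2 : B \ {e} = Z ∪ ((B \ Z) \ {e}) := by
    ext x
    have := @hZB x
    by_cases hx : x = e
    · subst hx
      simp [heZ]
    · simp [hx]
      tauto
  have h3 := M.natRk_union_le_add_ncard (X := Z) (Y := (B \ Z) \ {e})
    (Set.sdiff_subset.trans (Set.sdiff_subset.trans hB))
  have h4 := Set.ncard_sdiff_singleton_add_one (show e ∈ B \ Z from ⟨heB, heZ⟩)
    (M.ground_finite.subset (Set.sdiff_subset.trans hB))
  rw [← h2, ← natRk_closure, h1] at h3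
  omega

/-- A set `B` with cyclic part `Z` has rank `r(Z) + |B \ Z|`, so a `B` inside `V` spans `V` exactly
when its exponent is `r(V) - r(Z)`. -/
theorem coeff_basisPoly (hV : M.IsFlat V) :
    (M.basisPoly Z V).coeff k =
      if M.natRk V = M.natRk Z + k then (M.indepPoly Z V).coeff k else 0 := by
  split_ifs with h
  · rw [basisPoly, indepPoly, coeff_sizePoly, coeff_sizePoly]
    congr 2
    ext B
    simp only [mem_groundSets]
    refine and_congr_right fun hB => and_congr_left fun hk => and_congr_left ?_
    rintro rfl
    rw [← hk, ← natRk_eq_natRk_cyclicPart_add hB] at h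
    refine ⟨fun hBV => hBV ▸ M.subset_closure B hB, fun hBV => ?_⟩
    rw [closure_eq_closure_of_natRk_le hBV h.le, hV.closure]
  · refine coeff_sizePoly_eq_zero ?_
    rintro B hB ⟨rfl, rfl⟩ rfl
    rw [natRk_closure] at h
    exact h (natRk_eq_natRk_cyclicPart_add hB)

end Coefficients

/-! ### Factorizations indexed by a finite poset -/

section Incidence

variable {P : Type*} [PartialOrder P] [Fintype P]

theorem eq_of_sum_unitriangular_mul_eq {R : Type*} [CommRing R] {a : P → P → R}
    (ha : ∀ z v, ¬ z ≤ v → a z v = 0) (ha' : ∀ z, a z z = 1) {b b' : P → R}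
    (h : ∀ z, ∑ v, a z v * b v = ∑ v, a z v * b' v) : b = b' := by
  funext z
  -- Back substitution from the top of the poset: the terms other than `v = z` involve only larger
  -- `v`.
  induction z using WellFoundedGT.induction with
  | ind z ih =>
    have hz := h z
    rw [← Finset.add_sum_erase _ _ (Finset.mem_univ z),
      ← Finset.add_sum_erase _ _ (Finset.mem_univ z), ha', one_mul, one_mul] at hz
    have : ∑ v ∈ Finset.univ.erase z, a z v * b v = ∑ v ∈ Finset.univ.erase z, a z v * b' v := by
      refine Finset.sum_congr rfl fun v hv => ?_
      by_cases hzv : z ≤ v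
      · rw [ih v (lt_of_le_of_ne hzv (Finset.ne_of_mem_erase hv).symm)]
      · rw [ha z v hzv, zero_mul, zero_mul]
    rw [this] at hz
    exact add_right_cancel hz

/-- In a factorization `∑ v, σ z v * ι v w` of a given function, in which `σ` and `ι` are
unitriangular, the degrees of the terms of `ι z w` are at most `ρ w - ρ z`, and those of the terms
of `σ z w` are larger, the factors are determined. -/
theorem eq_of_sum_mul_eq_of_coeff_eq_zero {R : Type*} [CommRing R] (ρ : P → ℕ)
    {σ σ' ι ι' : P → P → R[X]}
    (hσ : ∀ z w, ¬ z ≤ w → σ z w = 0) (hσ' : ∀ z w, ¬ z ≤ w → σ' z w = 0)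
    (hι : ∀ z w, ¬ z ≤ w → ι z w = 0) (hι' : ∀ z w, ¬ z ≤ w → ι' z w = 0)
    (hσ₁ : ∀ z, σ z z = 1) (hσ₁' : ∀ z, σ' z z = 1)
    (hι₁ : ∀ z, ι z z = 1) (hι₁' : ∀ z, ι' z z = 1)
    (hσc : ∀ z w k, z < w → ρ z + k ≤ ρ w → (σ z w).coeff k = 0)
    (hσc' : ∀ z w k, z < w → ρ z + k ≤ ρ w → (σ' z w).coeff k = 0)
    (hιc : ∀ z w k, z < w → ρ w < ρ z + k → (ι z w).coeff k = 0)
    (hιc' : ∀ z w k, z < w → ρ w < ρ z + k → (ι' z w).coeff k = 0)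
    (h : ∀ z w, ∑ v, σ z v * ι v w = ∑ v, σ' z v * ι' v w) (z w : P) :
    σ z w = σ' z w ∧ ι z w = ι' z w := by
  -- Terms with `v` strictly between `z` and `w` involve only smaller intervals. The end terms
  -- contribute `σ z w + ι z w`, and in each degree one of these summands vanishes.
  induction hn : (Set.Icc z w).ncard using Nat.strong_induction_on generalizing z w with
  | _ n ih =>
    subst hn
    by_cases hzw : z ≤ w
    swap
    · simp [hσ z w hzw, hσ' z w hzw, hι z w hzw, hι' z w hzw]
    rcases hzw.eq_or_lt with rfl | hlt
    · simp [hσ₁, hσ₁', hι₁, hι₁']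
    have hz : z ∈ (Finset.univ : Finset P).erase w := by simp [hlt.ne]
    have hzw' := h z w
    rw [← Finset.add_sum_erase _ _ (Finset.mem_univ w), ← Finset.add_sum_erase _ _ hz,
      ← Finset.add_sum_erase _ _ (Finset.mem_univ w), ← Finset.add_sum_erase _ _ hz,
      hσ₁, hσ₁', hι₁, hι₁', mul_one, mul_one, one_mul, one_mul] at hzw'
    have hmid : ∑ v ∈ (Finset.univ.erase w).erase z, σ z v * ι v w =
        ∑ v ∈ (Finset.univ.erase w).erase z, σ' z v * ι' v w := by
      refine Finset.sum_congr rfl fun v hv => ?_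
      simp only [Finset.mem_erase, Finset.mem_univ, and_true] at hv
      by_cases h1 : z ≤ v
      swap
      · rw [hσ z v h1, hσ' z v h1, zero_mul, zero_mul]
      by_cases h2 : v ≤ w
      swap
      · rw [hι v w h2, hι' v w h2, mul_zero, mul_zero]
      rw [(ih _ (Set.ncard_lt_ncard ?_ (Set.toFinite _)) z v rfl).1,
        (ih _ (Set.ncard_lt_ncard ?_ (Set.toFinite _)) v w rfl).2]
      · refine ⟨Set.Icc_subset_Icc_left h1, fun hcon => hv.1 ?_⟩
        exact le_antisymm (hcon ⟨le_rfl, hzw⟩).1 h1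
      · refine ⟨Set.Icc_subset_Icc_right h2, fun hcon => hv.2 ?_⟩
        exact le_antisymm h2 (hcon ⟨hzw, le_rfl⟩).2
    rw [hmid, ← add_assoc, ← add_assoc] at hzw'
    have hsum := add_right_cancel hzw'
    have hcoeff : ∀ k, (σ z w).coeff k = (σ' z w).coeff k ∧ (ι z w).coeff k = (ι' z w).coeff k := by
      intro k
      have := congrArg (fun p => coeff p k) hsum
      simp only [coeff_add] at this
      rcases lt_or_ge (ρ w) (ρ z + k) with hk | hk
      · rw [hιc z w k hlt hk, hιc' z w k hlt hk, add_zero, add_zero] at this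
        exact ⟨this, by rw [hιc z w k hlt hk, hιc' z w k hlt hk]⟩
      · rw [hσc z w k hlt hk, hσc' z w k hlt hk, zero_add, zero_add] at this
        exact ⟨by rw [hσc z w k hlt hk, hσc' z w k hlt hk], this⟩
    exact ⟨Polynomial.ext fun k => (hcoeff k).1, Polynomial.ext fun k => (hcoeff k).2⟩

end Incidence

end Matroid

namespace Matroid

open Polynomial

theorem exists_equiv_of_card_fiber_eq {A B T : Type*} [Finite A] [Finite B] (p : A → T) (q : B → T)
    (h : ∀ t, Nat.card {a // p a = t} = Nat.card {b // q b = t}) :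
    ∃ φ : A ≃ B, ∀ a, q (φ a) = p a := by
  have h' : ∀ t, Nonempty ({a // p a = t} ≃ {b // q b = t}) := fun t => Finite.card_eq.1 (h t)
  exact ⟨Equiv.ofFiberEquiv fun t => (h' t).some, fun a => Equiv.ofFiberEquiv_map _ a⟩

/-! ### Comparing matroids with the same configuration -/

section Configuration

variable {α β L : Type*} [PartialOrder L] {M : Matroid α} [M.Finite] {N : Matroid β} [N.Finite]
  {s ρ : L → ℕ} {e : L ≃o M.CyclicFlat} {f : L ≃o N.CyclicFlat}

theorem sum_comp_orderIso [Fintype L] {R : Type*} [AddCommMonoid R] (e : L ≃o M.CyclicFlat)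
    (g : M.CyclicFlat → R) : ∑ x, g (e x) = ∑ V, g V :=
  e.toEquiv.sum_comp g

theorem intervalPoly_congr {Z F : Set α} {Z' F' : Set β} (hF : F ⊆ M.E) (hF' : F' ⊆ N.E)
    (h : Z ⊆ F ↔ Z' ⊆ F') (hZ : Z.ncard = Z'.ncard) (hFF' : F.ncard = F'.ncard) :
    M.intervalPoly Z F = N.intervalPoly Z' F' := by
  by_cases hZF : Z ⊆ F
  · have h1 := M.ncard_add_ncard_sdiff hZF hF
    have h2 := N.ncard_add_ncard_sdiff (h.1 hZF) hF'
    rw [intervalPoly_of_subset M hZF hF, intervalPoly_of_subset N (h.1 hZF) hF',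
      show (F \ Z).ncard = (F' \ Z').ncard by omega]
  · rw [intervalPoly_eq_zero hZF, intervalPoly_eq_zero (mt h.2 hZF)]

/-- Both matroids factor the same interval polynomials, which depend only on the order, `s` and the
degree bounds given by `ρ`, so uniqueness of the factorization applies. -/
theorem spanPoly_indepPoly_congr
    (he : ∀ x, s x = (e x).1.ncard ∧ ρ x = M.natRk (e x).1)
    (hf : ∀ x, s x = (f x).1.ncard ∧ ρ x = N.natRk (f x).1) (x y : L) :
    M.spanPoly (e x).1 (e y).1 = N.spanPoly (f x).1 (f y).1 ∧
      M.indepPoly (e x).1 (e y).1 = N.indepPoly (f x).1 (f y).1 := by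
  have : Finite L := Finite.of_equiv _ e.symm.toEquiv
  have := Fintype.ofFinite L
  have hle : ∀ {x y : L}, ¬ x ≤ y → ¬ (e x).1 ⊆ (e y).1 := fun h h' => h (e.le_iff_le.1 h')
  have hle' : ∀ {x y : L}, ¬ x ≤ y → ¬ (f x).1 ⊆ (f y).1 := fun h h' => h (f.le_iff_le.1 h')
  refine eq_of_sum_mul_eq_of_coeff_eq_zero ρ
    (σ := fun x y => M.spanPoly (e x).1 (e y).1) (σ' := fun x y => N.spanPoly (f x).1 (f y).1)
    (ι := fun x y => M.indepPoly (e x).1 (e y).1) (ι' := fun x y => N.indepPoly (f x).1 (f y).1)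
    (fun z w h => spanPoly_eq_zero (hle h)) (fun z w h => spanPoly_eq_zero (hle' h))
    (fun z w h => indepPoly_eq_zero (hle h)) (fun z w h => indepPoly_eq_zero (hle' h))
    (fun z => spanPoly_self (e z).2.1 (e z).2.2) (fun z => spanPoly_self (f z).2.1 (f z).2.2)
    (fun z => indepPoly_self (e z).2.2 (e z).2.1.subset_ground)
    (fun z => indepPoly_self (f z).2.2 (f z).2.1.subset_ground)
    ?_ ?_ ?_ ?_ ?_ x y
  · intro z w k hzw hk
    rw [(he z).2, (he w).2] at hk
    exact coeff_spanPoly_eq_zero (e z).2.1 (fun h => hzw.ne (e.injective (Subtype.ext h))) hk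
  · intro z w k hzw hk
    rw [(hf z).2, (hf w).2] at hk
    exact coeff_spanPoly_eq_zero (f z).2.1 (fun h => hzw.ne (f.injective (Subtype.ext h))) hk
  · intro z w k hzw hk
    rw [(he z).2, (he w).2] at hk
    exact coeff_indepPoly_eq_zero hk
  · intro z w k hzw hk
    rw [(hf z).2, (hf w).2] at hk
    exact coeff_indepPoly_eq_zero hk
  · intro z w
    rw [sum_comp_orderIso e (fun V => M.spanPoly (e z).1 V.1 * M.indepPoly V.1 (e w).1),
      sum_comp_orderIso f (fun V => N.spanPoly (f z).1 V.1 * N.indepPoly V.1 (f w).1),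
      ← intervalPoly_eq_sum (e z).2.2 (e w).2.1, ← intervalPoly_eq_sum (f z).2.2 (f w).2.1]
    refine intervalPoly_congr (e w).2.1.subset_ground (f w).2.1.subset_ground ?_ ?_ ?_
    · exact (e.le_iff_le (x := z) (y := w)).trans (f.le_iff_le (x := z) (y := w)).symm
    · rw [← (he z).1, (hf z).1]
    · rw [← (he w).1, (hf w).1]

/-- The type of a flat `F`: its cyclic part, as an element of `L`, and the number of coloops of
`M | F`. -/
noncomputable def flatType (e : L ≃o M.CyclicFlat) (F : {F // M.IsFlat F}) : L × ℕ :=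
  (e.symm F.2.cyclicFlat, (F.1 \ M.cyclicPart F.1).ncard)

variable {F : {F // M.IsFlat F}} {F' : {F // N.IsFlat F}}

omit [M.Finite] in
theorem cyclicPart_eq_flatType (e : L ≃o M.CyclicFlat) (F : {F // M.IsFlat F}) :
    (e (flatType e F).1).1 = M.cyclicPart F.1 := by
  simp [flatType, IsFlat.cyclicFlat]

omit [M.Finite] in
theorem subset_iff_le_flatType (x : L) : (e x).1 ⊆ F.1 ↔ x ≤ (flatType e F).1 := by
  rw [← IsFlat.subset_cyclicPart_iff (e x).2, ← cyclicPart_eq_flatType e F]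
  exact e.le_iff_le

theorem ncard_eq_flatType (he : ∀ x, s x = (e x).1.ncard ∧ ρ x = M.natRk (e x).1) :
    F.1.ncard = s (flatType e F).1 + (flatType e F).2 := by
  rw [(he _).1, cyclicPart_eq_flatType]
  exact (M.ncard_add_ncard_sdiff (M.cyclicPart_subset F.1) F.2.subset_ground).symm

theorem natRk_eq_flatType (he : ∀ x, s x = (e x).1.ncard ∧ ρ x = M.natRk (e x).1) :
    M.natRk F.1 = ρ (flatType e F).1 + (flatType e F).2 := by
  rw [(he _).2, cyclicPart_eq_flatType]
  exact natRk_eq_natRk_cyclicPart_add F.2.subset_ground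

theorem flatPoly_congr (he : ∀ x, s x = (e x).1.ncard ∧ ρ x = M.natRk (e x).1)
    (hf : ∀ x, s x = (f x).1.ncard ∧ ρ x = N.natRk (f x).1)
    (h : flatType e F = flatType f F') (x : L) :
    M.flatPoly (e x).1 F.1 = N.flatPoly (f x).1 F'.1 := by
  have : Finite L := Finite.of_equiv _ e.symm.toEquiv
  have := Fintype.ofFinite L
  have hle : ∀ {x y : L}, ¬ x ≤ y → ¬ (e x).1 ⊆ (e y).1 := fun h h' => h (e.le_iff_le.1 h')
  -- The unitriangular span polynomials, already known to agree, are cancelled here; below, the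
  -- basis polynomials are cancelled in the same way.
  have hind : (fun x => M.indepPoly (e x).1 F.1) = fun x => N.indepPoly (f x).1 F'.1 := by
    refine eq_of_sum_unitriangular_mul_eq (a := fun x y => M.spanPoly (e x).1 (e y).1)
      (fun z v h => spanPoly_eq_zero (hle h)) (fun z => spanPoly_self (e z).2.1 (e z).2.2) ?_
    intro z
    rw [sum_comp_orderIso e (fun V => M.spanPoly (e z).1 V.1 * M.indepPoly V.1 F.1),
      ← intervalPoly_eq_sum (e z).2.2 F.2]
    simp only [(spanPoly_indepPoly_congr he hf z _).1]
    rw [sum_comp_orderIso f (fun V => N.spanPoly (f z).1 V.1 * N.indepPoly V.1 F'.1),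
      ← intervalPoly_eq_sum (f z).2.2 F'.2]
    refine intervalPoly_congr F.2.subset_ground F'.2.subset_ground ?_ ?_ ?_
    · rw [subset_iff_le_flatType, subset_iff_le_flatType, h]
    · rw [← (he z).1, (hf z).1]
    · rw [ncard_eq_flatType he, ncard_eq_flatType hf, h]
  have hbasis : ∀ z v, M.basisPoly (e z).1 (e v).1 = N.basisPoly (f z).1 (f v).1 := by
    intro z v
    ext k
    rw [coeff_basisPoly (e v).2.1, coeff_basisPoly (f v).2.1, ← (he z).2, ← (he v).2,
      ← (hf z).2, ← (hf v).2, (spanPoly_indepPoly_congr he hf z v).2]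
  refine congrFun (eq_of_sum_unitriangular_mul_eq
    (a := fun x y => M.basisPoly (e x).1 (e y).1)
    (b := fun x => M.flatPoly (e x).1 F.1) (b' := fun x => N.flatPoly (f x).1 F'.1)
    (fun z v h => basisPoly_eq_zero (hle h)) (fun z => basisPoly_self (e z).2.1 (e z).2.2) ?_) x
  intro z
  rw [sum_comp_orderIso e (fun V => M.basisPoly (e z).1 V.1 * M.flatPoly V.1 F.1),
    ← indepPoly_eq_sum F.2]
  simp only [hbasis]
  rw [sum_comp_orderIso f (fun V => N.basisPoly (f z).1 V.1 * N.flatPoly V.1 F'.1),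
    ← indepPoly_eq_sum F'.2]
  exact congrFun hind z

theorem card_flatType_eq (e : L ≃o M.CyclicFlat) (F : {F // M.IsFlat F}) (t : L × ℕ) :
    (Nat.card {H : {H : {H // M.IsFlat H} // H.1 ⊆ F.1} // flatType e H.1 = t} : ℤ) =
      (M.flatPoly (e t.1).1 F.1).coeff t.2 := by
  rw [flatPoly, coeff_sizePoly, ← Fintype.card_coe, ← Nat.card_eq_fintype_card]
  congr 1
  refine Nat.card_congr ⟨fun H => ⟨H.1.1.1, ?_⟩, fun B => ⟨⟨⟨B.1, ?_⟩, ?_⟩, ?_⟩, ?_, ?_⟩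
  · obtain ⟨H, rfl⟩ := H
    rw [mem_groundSets, cyclicPart_eq_flatType]
    exact ⟨H.1.2.subset_ground, ⟨⟨H.1.2, H.2⟩, rfl⟩, rfl⟩
  · exact (mem_groundSets.1 B.2).2.1.1.1
  · exact (mem_groundSets.1 B.2).2.1.1.2
  · obtain ⟨-, ⟨⟨hB, -⟩, hB'⟩, hk⟩ := mem_groundSets.1 B.2
    refine Prod.ext ?_ ?_
    · refine e.injective (Subtype.ext ?_)
      rw [cyclicPart_eq_flatType, hB']
    · change (B.1 \ M.cyclicPart B.1).ncard = t.2
      rw [hB', hk]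
  · exact fun _ => rfl
  · exact fun _ => rfl

instance (M : Matroid α) [M.Finite] : Finite {F // M.IsFlat F} :=
  Set.Finite.to_subtype (M.ground_finite.finite_subsets.subset fun _ hX => hX.subset_ground)

/-- Flats of the same type contain equally many flats of each type. -/
theorem exists_equiv_flatType_eq (he : ∀ x, s x = (e x).1.ncard ∧ ρ x = M.natRk (e x).1)
    (hf : ∀ x, s x = (f x).1.ncard ∧ ρ x = N.natRk (f x).1)
    (h : flatType e F = flatType f F') :
    ∃ φ : {H : {H // M.IsFlat H} // H.1 ⊆ F.1} ≃ {H : {H // N.IsFlat H} // H.1 ⊆ F'.1},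
      ∀ H, flatType f (φ H).1 = flatType e H.1 := by
  refine exists_equiv_of_card_fiber_eq
    (fun H : {H : {H // M.IsFlat H} // H.1 ⊆ F.1} => flatType e H.1)
    (fun H : {H : {H // N.IsFlat H} // H.1 ⊆ F'.1} => flatType f H.1) ?_
  intro t
  have h1 := card_flatType_eq e F t
  rw [flatPoly_congr he hf h, ← card_flatType_eq f F' t] at h1
  exact_mod_cast h1

end Configuration

/-! ### Flags -/

section Chains

variable {α : Type*} {M : Matroid α} {r : ℕ}

/-- The chains of flats of ranks `0, 1, …, r` that end with `F`. -/
def flatChains (M : Matroid α) (r : ℕ) (F : Set α) : Set (Fin (r + 1) → Set α) :=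
  {X | (∀ j, M.IsFlat (X j) ∧ M.natRk (X j) = j) ∧ (∀ j : Fin r, X j.castSucc ⊆ X j.succ) ∧
    X (Fin.last r) = F}

theorem monotone_of_mem_flatChains {F : Set α} {X : Fin (r + 1) → Set α}
    (hX : X ∈ M.flatChains r F) : Monotone X :=
  Fin.monotone_iff_le_succ.2 hX.2.1

theorem isEmpty_flatChains {F : Set α} (h : M.natRk F ≠ r) : IsEmpty (M.flatChains r F) :=
  ⟨fun X => h (by simpa [X.2.2.2] using (X.2.1 (Fin.last r)).2)⟩

theorem const_mem_flatChains {F : Set α} (hF : M.IsFlat F) (h : M.natRk F = 0) :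
    (fun _ => F) ∈ M.flatChains 0 F :=
  ⟨fun j => ⟨hF, by rw [h]; omega⟩, fun j => j.elim0, rfl⟩

theorem eq_const_of_mem_flatChains {F : Set α} {X : Fin 1 → Set α} (h : X ∈ M.flatChains 0 F) :
    X = fun _ => F := by
  funext j
  rw [Subsingleton.elim j (Fin.last 0), h.2.2]

/-- The rank conditions supply what the right side omits: a rank-0 flat is the closure of ∅, and
distinct indices give distinct ranks. -/
theorem isFlag_iff [M.Finite] {X : Fin (M.natRank + 1) → Set α} :
    M.IsFlag X ↔ X ∈ M.flatChains M.natRank M.E := by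
  constructor
  · exact fun h => ⟨fun j => ⟨h.isFlat j, h.natRk_eq j⟩,
      fun j => h.strictMono.monotone j.castSucc_lt_succ.le, h.top_eq⟩
  · intro h
    have hmono := monotone_of_mem_flatChains h
    refine ⟨?_, h.2.2, hmono.strictMono_of_injective fun i j hij => ?_, fun j => (h.1 j).1,
      fun j => (h.1 j).2⟩
    · refine ((M.isFlat_closure ∅).eq_of_natRk_le (h.1 0).1 ?_ ?_).symm
      · rw [← (h.1 0).1.closure]
        exact M.closure_subset_closure (Set.empty_subset _)
      · rw [(h.1 0).2]
        exact Nat.zero_le _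
    · have := (h.1 i).2
      rw [hij, (h.1 j).2] at this
      exact (Fin.ext this).symm

theorem flagComp_snoc (X : Fin (r + 1) → Set α) (F : Set α) :
    flagComp (Fin.snoc X F : Fin (r + 2) → Set α) =
      flagComp X ++ [(F \ X (Fin.last r)).ncard] := by
  rw [flagComp, flagComp, List.ofFn_succ', List.concat_eq_append, List.cons_append]
  have h0 : (Fin.snoc X F : Fin (r + 2) → Set α) 0 = X 0 := by
    rw [← Fin.castSucc_zero, Fin.snoc_castSucc]
  simp only [h0, Fin.succ_castSucc, Fin.snoc_castSucc, Fin.succ_last, Fin.snoc_last]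

theorem snoc_mem_flatChains {X : Fin (r + 1) → Set α} {F H : Set α} (hX : X ∈ M.flatChains r H)
    (hF : M.IsFlat F) (hr : M.natRk F = r + 1) (hHF : H ⊆ F) :
    (Fin.snoc X F : Fin (r + 2) → Set α) ∈ M.flatChains (r + 1) F := by
  refine ⟨fun j => ?_, fun j => ?_, by simp⟩
  · induction j using Fin.lastCases with
    | last => simpa using ⟨hF, hr⟩
    | cast j => simpa using hX.1 j
  · induction j using Fin.lastCases with
    | last => simpa [Fin.succ_last, hX.2.2] using hHF
    | cast j => simpa only [Fin.succ_castSucc, Fin.snoc_castSucc] using hX.2.1 j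

/-- A chain of flats is determined by its last two members and the chain up to the penultimate
one. -/
noncomputable def flatChainsSuccEquiv {F : Set α} (hF : M.IsFlat F) (hr : M.natRk F = r + 1) :
    (Σ H : {H : {H // M.IsFlat H} // H.1 ⊆ F}, M.flatChains r H.1.1) ≃ M.flatChains (r + 1) F :=
  Equiv.ofBijective (fun P => ⟨Fin.snoc P.2.1 F, snoc_mem_flatChains P.2.2 hF hr P.1.2⟩) <| by
    constructor
    · rintro ⟨⟨⟨H, hH⟩, hHF⟩, X, hX⟩ ⟨⟨⟨H', hH'⟩, hHF'⟩, X', hX'⟩ h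
      obtain rfl : X = X' := by
        have h' := congrArg (fun Y => Fin.init (α := fun _ => Set α) Y.1) h
        simpa using h'
      obtain rfl : H = H' := hX.2.2.symm.trans hX'.2.2
      rfl
    · rintro ⟨X, hX⟩
      refine ⟨⟨⟨⟨X (Fin.last r).castSucc, (hX.1 _).1⟩, ?_⟩,
        ⟨Fin.init X, fun j => ?_, fun j => ?_, rfl⟩⟩, Subtype.ext ?_⟩
      · have := hX.2.1 (Fin.last r)
        rwa [Fin.succ_last, hX.2.2] at this
      · exact hX.1 j.castSucc
      · exact hX.2.1 j.castSucc
      · change (Fin.snoc (Fin.init X) F : Fin (r + 2) → Set α) = X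
        rw [← hX.2.2, Fin.snoc_init_self]

theorem catenaryData_eq_ncard [M.Finite] (hr : M.natRank = r) (a : List ℕ) :
    M.catenaryData a = {X | X ∈ M.flatChains r M.E ∧ flagComp X = a}.ncard := by
  subst hr
  simp only [catenaryData, isFlag_iff]

/-- The penultimate members are matched by type, and the chains below them by induction. Equal types
have equal sizes, so the last block of the composition agrees too. -/
theorem exists_flatChains_equiv {β L : Type*} [PartialOrder L] [M.Finite] {N : Matroid β}
    [N.Finite] {s ρ : L → ℕ} {e : L ≃o M.CyclicFlat} {f : L ≃o N.CyclicFlat}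
    (he : ∀ x, s x = (e x).1.ncard ∧ ρ x = M.natRk (e x).1)
    (hf : ∀ x, s x = (f x).1.ncard ∧ ρ x = N.natRk (f x).1)
    (r : ℕ) {F : {F // M.IsFlat F}} {F' : {F // N.IsFlat F}}
    (h : flatType e F = flatType f F') :
    ∃ φ : M.flatChains r F.1 ≃ N.flatChains r F'.1, ∀ X, flagComp (φ X).1 = flagComp X.1 := by
  induction r generalizing F F' with
  | zero =>
    have hrk : M.natRk F.1 = N.natRk F'.1 := by
      rw [natRk_eq_flatType he, natRk_eq_flatType hf, h]
    by_cases hr : M.natRk F.1 = 0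
    swap
    · have := isEmpty_flatChains hr
      have := isEmpty_flatChains (hrk ▸ hr)
      exact ⟨Equiv.equivOfIsEmpty _ _, fun X => isEmptyElim X⟩
    have hcard : F.1.ncard = F'.1.ncard := by
      rw [ncard_eq_flatType he, ncard_eq_flatType hf, h]
    refine ⟨⟨fun _ => ⟨fun _ => F'.1, const_mem_flatChains F'.2 (hrk ▸ hr)⟩,
      fun _ => ⟨fun _ => F.1, const_mem_flatChains F.2 hr⟩, ?_, ?_⟩, ?_⟩
    · exact fun X => Subtype.ext (eq_const_of_mem_flatChains X.2).symm
    · exact fun X => Subtype.ext (eq_const_of_mem_flatChains X.2).symm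
    · intro X
      rw [eq_const_of_mem_flatChains X.2]
      simp [flagComp, hcard]
  | succ r ih =>
    have hrk : M.natRk F.1 = N.natRk F'.1 := by
      rw [natRk_eq_flatType he, natRk_eq_flatType hf, h]
    by_cases hr : M.natRk F.1 = r + 1
    swap
    · have := isEmpty_flatChains hr
      have := isEmpty_flatChains (hrk ▸ hr)
      exact ⟨Equiv.equivOfIsEmpty _ _, fun X => isEmptyElim X⟩
    obtain ⟨φ, hφ⟩ := exists_equiv_flatType_eq he hf h
    have hψ := fun H => ih (hφ H).symm
    choose ψ hψ using hψ
    refine ⟨(flatChainsSuccEquiv F.2 hr).symm.trans ((Equiv.sigmaCongr φ ψ).trans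
      (flatChainsSuccEquiv F'.2 (hrk ▸ hr))), fun X => ?_⟩
    obtain ⟨⟨H, X⟩, rfl⟩ := (flatChainsSuccEquiv F.2 hr).surjective X
    simp only [Equiv.trans_apply, Equiv.symm_apply_apply]
    change flagComp (Fin.snoc (ψ H X).1 F'.1 : Fin (r + 2) → Set β) =
      flagComp (Fin.snoc X.1 F.1 : Fin (r + 2) → Set α)
    rw [flagComp_snoc, flagComp_snoc, hψ, (ψ H X).2.2.2, X.2.2.2]
    have h1 := M.ncard_add_ncard_sdiff H.2 F.2.subset_ground
    have h2 := N.ncard_add_ncard_sdiff (φ H).2 F'.2.subset_ground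
    have h3 : H.1.1.ncard = (φ H).1.1.ncard := by
      rw [ncard_eq_flatType he, ncard_eq_flatType hf, hφ]
    have h4 : F.1.ncard = F'.1.ncard := by
      rw [ncard_eq_flatType he, ncard_eq_flatType hf, h]
    congr 2
    omega

end Chains

end Matroid

namespace Matroid

/-! ### Orderings -/

section Orderings

variable {α : Type*} {M : Matroid α} {r n : ℕ}

/-- The set of the first `j` terms of a sequence. -/
def seqPrefix (u : Fin n → α) (j : ℕ) : Set α :=
  {x | ∃ i : Fin n, (i : ℕ) < j ∧ u i = x}

theorem seqPrefix_zero (u : Fin n → α) : seqPrefix u 0 = ∅ := by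
  simp [seqPrefix]

theorem seqPrefix_mono (u : Fin n → α) : Monotone (seqPrefix u) := by
  rintro i j hij x ⟨k, hk, rfl⟩
  exact ⟨k, hk.trans_le hij, rfl⟩

theorem seqPrefix_succ (u : Fin n → α) (j : Fin n) :
    seqPrefix u (j + 1) = insert (u j) (seqPrefix u j) := by
  ext x
  simp only [seqPrefix, Set.mem_ofPred_eq, Set.mem_insert_iff]
  constructor
  · rintro ⟨i, hi, rfl⟩
    rcases Nat.lt_succ_iff_lt_or_eq.1 hi with h | h
    · exact Or.inr ⟨i, h, rfl⟩
    · exact Or.inl (congrArg u (Fin.ext h))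
  · rintro (rfl | ⟨i, hi, rfl⟩)
    · exact ⟨j, Nat.lt_succ_self _, rfl⟩
    · exact ⟨i, hi.trans (Nat.lt_succ_self _), rfl⟩

theorem seqPrefix_add_one_of_le (u : Fin n → α) {j : ℕ} (hj : n ≤ j) :
    seqPrefix u (j + 1) = seqPrefix u j :=
  subset_antisymm (fun _ ⟨i, _, hi⟩ => ⟨i, i.2.trans_le hj, hi⟩)
    (seqPrefix_mono u (Nat.le_succ j))

variable [M.Finite] {X Y : Fin (r + 1) → Set α}

theorem natRk_seqPrefix_add_one_le (M : Matroid α) [M.Finite] (u : Fin n → α) (j : ℕ) :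
    M.natRk (seqPrefix u (j + 1)) ≤ M.natRk (seqPrefix u j) + 1 := by
  by_cases hj : j < n
  · rw [seqPrefix_succ u ⟨j, hj⟩]
    exact M.natRk_insert_le _ _
  · rw [seqPrefix_add_one_of_le u (not_lt.1 hj)]
    exact Nat.le_succ _

/-- The chain `X` consists of the closures of the initial segments of `u`. -/
def IsAdapted (X : Fin (r + 1) → Set α) (u : Fin n → α) : Prop :=
  ∀ (j : Fin n) (i : Fin r), seqPrefix u j ⊆ X i.castSucc → u j ∈ X i.succ

variable {u : Fin n → α}

/-- The rank of an initial segment can thus be read off from membership in the chain. If the earlier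
segment has rank below `i`, adaptedness puts the next element in `X i`; if its rank is already `i`,
the next element lies in its closure. -/
theorem IsAdapted.seqPrefix_subset_iff (h : IsAdapted X u) (hX : X ∈ M.flatChains r M.E)
    (hu : ∀ j, u j ∈ M.E) (j : ℕ) (i : Fin (r + 1)) :
    seqPrefix u j ⊆ X i ↔ M.natRk (seqPrefix u j) ≤ i := by
  refine ⟨fun hj => (hX.1 i).2 ▸ M.natRk_mono hj, ?_⟩
  induction j generalizing i with
  | zero => simp [seqPrefix_zero]
  | succ j ih =>
    intro hi
    by_cases hjn : j < n
    swap
    · rw [seqPrefix_add_one_of_le u (not_lt.1 hjn)] at hi ⊢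
      exact ih i hi
    have hle := M.natRk_mono (seqPrefix_mono u (Nat.le_succ j))
    have hjX := ih i (hle.trans hi)
    rcases (hle.trans hi).lt_or_eq with hlt | heq
    · rw [seqPrefix_succ u ⟨j, hjn⟩]
      refine Set.insert_subset ?_ hjX
      obtain ⟨i, rfl⟩ := Fin.exists_succ_eq.2 (fun h0 : i = 0 => by simp [h0] at hlt)
      refine h ⟨j, hjn⟩ i (ih i.castSucc ?_)
      simpa [Nat.lt_succ_iff] using hlt
    · have hcl := closure_eq_closure_of_natRk_le (seqPrefix_mono u (Nat.le_succ j))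
        (hi.trans heq.ge)
      rw [← (hX.1 i).1.closure]
      refine (M.subset_closure _ ?_).trans (hcl ▸ M.closure_subset_closure hjX)
      rintro _ ⟨k, -, rfl⟩
      exact hu k

variable (u) in
theorem exists_natRk_seqPrefix_eq (hu : M.E ⊆ Set.range u) {i : ℕ} (hi : i ≤ M.natRank) :
    ∃ j, M.natRk (seqPrefix u j) = i := by
  classical
  have hex : ∃ j, i ≤ M.natRk (seqPrefix u j) := by
    refine ⟨n, hi.trans (M.natRk_mono fun x hx => ?_)⟩
    obtain ⟨k, rfl⟩ := hu hx
    exact ⟨k, k.2, rfl⟩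
  -- Ranks of initial segments grow by at most 1, so the first one to reach `i` equals `i`.
  refine ⟨Nat.find hex, le_antisymm ?_ (Nat.find_spec hex)⟩
  rcases hj : Nat.find hex with _ | j
  · simp [seqPrefix_zero, natRk]
  · have h1 := Nat.find_min hex (m := j) (by omega)
    have h2 := M.natRk_seqPrefix_add_one_le u j
    omega

/-- An adapted chain has no freedom: `X i` is the closure of any initial segment of rank `i`. -/
theorem IsAdapted.eq (hXu : IsAdapted X u) (hYu : IsAdapted Y u) (hX : X ∈ M.flatChains r M.E)
    (hY : Y ∈ M.flatChains r M.E) (hu : Set.range u = M.E) : X = Y := by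
  funext i
  have hr : r = M.natRank := by
    have := (hX.1 (Fin.last r)).2
    rw [hX.2.2] at this
    exact this.symm
  obtain ⟨j, hj⟩ := M.exists_natRk_seqPrefix_eq u hu.symm.subset (i := i) (hr ▸ i.is_le)
  have hmem : ∀ j, u j ∈ M.E := fun j => hu ▸ Set.mem_range_self j
  have key : ∀ {Z : Fin (r + 1) → Set α}, IsAdapted Z u → Z ∈ M.flatChains r M.E →
      Z i = M.closure (seqPrefix u j) := fun {Z} h hZ => by
    rw [closure_eq_closure_of_natRk_le ((h.seqPrefix_subset_iff hZ hmem j i).2 hj.le)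
      ((hZ.1 i).2.trans hj.symm).le, (hZ.1 i).1.closure]
  rw [key hXu hX, key hYu hY]

theorem exists_isAdapted (hr : M.natRank = r) (hu : Set.range u = M.E) :
    ∃ X ∈ M.flatChains r M.E, IsAdapted X u := by
  have hJ : ∀ i : Fin (r + 1), ∃ j, M.natRk (seqPrefix u j) = i := fun i =>
    M.exists_natRk_seqPrefix_eq u hu.symm.subset (hr ▸ i.is_le)
  choose J hJ using hJ
  have hE : ∀ j, seqPrefix u j ⊆ M.E := by
    rintro j _ ⟨k, -, rfl⟩
    exact hu ▸ Set.mem_range_self k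
  have hsub : ∀ (j : ℕ) (i : Fin (r + 1)), M.natRk (seqPrefix u j) ≤ i →
      seqPrefix u j ⊆ M.closure (seqPrefix u (J i)) := by
    intro j i hji
    rcases le_total j (J i) with h | h
    · exact (seqPrefix_mono u h).trans (M.subset_closure _ (hE _))
    · rw [closure_eq_closure_of_natRk_le (seqPrefix_mono u h) (hji.trans (hJ i).ge)]
      exact M.subset_closure _ (hE _)
  have hrk : ∀ i, M.natRk (M.closure (seqPrefix u (J i))) = i := fun i => by
    rw [natRk_closure, hJ]
  refine ⟨fun i => M.closure (seqPrefix u (J i)), ⟨fun i => ⟨M.isFlat_closure _, hrk i⟩, ?_, ?_⟩, ?_⟩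
  · intro i
    change M.closure _ ⊆ M.closure _
    rw [← closure_closure M (seqPrefix u (J i.succ))]
    refine M.closure_subset_closure (hsub _ _ ?_)
    rw [hJ]
    exact i.castSucc_lt_succ.le
  · refine (M.isFlat_closure _).eq_of_natRk_le M.ground_isFlat (M.closure_subset_ground _) ?_
    rw [hrk, Fin.val_last, ← hr]
    rfl
  · intro j i hji
    refine hsub (j + 1) i.succ ?_ ⟨j, Nat.lt_succ_self _, rfl⟩
    have h1 := M.natRk_mono hji
    rw [hrk] at h1
    have h2 := M.natRk_seqPrefix_add_one_le u j
    simp only [Fin.val_castSucc, Fin.val_succ] at h1 ⊢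
    omega

end Orderings

/-! ### Bijections that carry one chain to another -/

section Transport

variable {α β : Type*} {M : Matroid α} {N : Matroid β} [M.Finite] [N.Finite] {r n : ℕ}
  {X : Fin (r + 1) → Set α} {Y : Fin (r + 1) → Set β}

/-- The least index of a member of the chain `X` that contains `x`. -/
noncomputable def chainLevel (X : Fin (r + 1) → Set α) (x : α) : ℕ :=
  sInf {i | ∃ h : i < r + 1, x ∈ X ⟨i, h⟩}

-- Outside the ground set the infimum is over ∅ and equals 0, so `hx` is needed.
omit [M.Finite] in
theorem mem_iff_chainLevel_le (hX : X ∈ M.flatChains r M.E) {x : α} (hx : x ∈ M.E)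
    (i : Fin (r + 1)) : x ∈ X i ↔ chainLevel X x ≤ i := by
  refine ⟨fun h => Nat.sInf_le ⟨i.2, h⟩, fun h => ?_⟩
  obtain ⟨h', hx'⟩ := Nat.sInf_mem (s := {i | ∃ h : i < r + 1, x ∈ X ⟨i, h⟩})
    ⟨r, Nat.lt_succ_self r, hX.2.2 ▸ hx⟩
  exact monotone_of_mem_flatChains hX (show ⟨_, h'⟩ ≤ i from h) hx'

omit [M.Finite] in
theorem setOf_chainLevel_eq (hX : X ∈ M.flatChains r M.E) (k : ℕ) :
    {x ∈ M.E | chainLevel X x = k} =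
      if h : k < r + 1 then Fin.cases (X 0) (fun j => X j.succ \ X j.castSucc) (⟨k, h⟩ : Fin (r + 1))
      else ∅ := by
  have hXE : ∀ i, X i ⊆ M.E := fun i => (hX.1 i).1.subset_ground
  ext x
  split_ifs with h
  · obtain ⟨k, rfl⟩ : ∃ k' : Fin (r + 1), (k' : ℕ) = k := ⟨⟨k, h⟩, rfl⟩
    induction k using Fin.cases with
    | zero =>
      simp only [Fin.eta, Fin.cases_zero, Set.mem_ofPred_eq]
      refine ⟨fun hx => (mem_iff_chainLevel_le hX hx.1 0).2 hx.2.le, fun hx => ⟨hXE _ hx, ?_⟩⟩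
      exact Nat.le_zero.1 ((mem_iff_chainLevel_le hX (hXE _ hx) 0).1 hx)
    | succ k =>
      simp only [Fin.eta, Fin.cases_succ, Set.mem_ofPred_eq, Set.mem_sdiff]
      refine ⟨fun hx => ?_, fun hx => ⟨hXE _ hx.1, ?_⟩⟩
      · rw [mem_iff_chainLevel_le hX hx.1, mem_iff_chainLevel_le hX hx.1, hx.2]
        simp
      · have hxE := hXE _ hx.1
        rw [mem_iff_chainLevel_le hX hxE, mem_iff_chainLevel_le hX hxE] at hx
        simp at hx ⊢
        omega
  · simp only [Set.mem_ofPred_eq, Set.mem_empty_iff_false, iff_false, not_and]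
    rintro hx rfl
    have := (mem_iff_chainLevel_le hX hx (Fin.last r)).1 (hX.2.2 ▸ hx)
    simp at this
    omega

/-- The composition lists the sizes of the level classes, so bijections between classes of equal
level glue together. -/
theorem exists_equiv_ground_of_flagComp_eq (hX : X ∈ M.flatChains r M.E)
    (hY : Y ∈ N.flatChains r N.E) (h : flagComp X = flagComp Y) :
    ∃ g : M.E ≃ N.E, ∀ (x : M.E) i, (g x).1 ∈ Y i ↔ x.1 ∈ X i := by
  have hcard : ∀ k, {x ∈ M.E | chainLevel X x = k}.ncard = {y ∈ N.E | chainLevel Y y = k}.ncard := by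
    intro k
    rw [setOf_chainLevel_eq hX, setOf_chainLevel_eq hY]
    split_ifs with hk
    · rw [flagComp, flagComp, List.cons.injEq] at h
      have h2 := List.ofFn_injective h.2
      induction (⟨k, hk⟩ : Fin (r + 1)) using Fin.cases with
      | zero => exact h.1
      | succ j => exact congrFun h2 j
    · simp
  have := M.ground_finite.to_subtype
  have := N.ground_finite.to_subtype
  obtain ⟨g, hg⟩ := exists_equiv_of_card_fiber_eq (fun x : M.E => chainLevel X x.1)
    (fun y : N.E => chainLevel Y y.1) fun k => by
      rw [Nat.card_congr (Equiv.subtypeSubtypeEquivSubtypeInter (· ∈ M.E)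
        fun x => chainLevel X x = k), Nat.card_congr (Equiv.subtypeSubtypeEquivSubtypeInter (· ∈ N.E)
        fun x => chainLevel Y x = k)]
      exact hcard k
  refine ⟨g, fun x i => ?_⟩
  rw [mem_iff_chainLevel_le hX x.2, mem_iff_chainLevel_le hY (g x).2, hg]

/-- The rank sequence of a sequence of elements. -/
noncomputable def seqRanks (M : Matroid α) (u : Fin n → α) : List ℕ :=
  List.ofFn fun j : Fin n => M.natRk (seqPrefix u (j + 1)) - M.natRk (seqPrefix u j)

variable {u : Fin n → α} {v : Fin n → β}

theorem seqPrefix_subset_iff_of_mem_iff (h : ∀ j i, v j ∈ Y i ↔ u j ∈ X i) (j : ℕ)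
    (i : Fin (r + 1)) : seqPrefix v j ⊆ Y i ↔ seqPrefix u j ⊆ X i := by
  constructor
  · rintro hv _ ⟨k, hk, rfl⟩
    exact (h k i).1 (hv ⟨k, hk, rfl⟩)
  · rintro hu _ ⟨k, hk, rfl⟩
    exact (h k i).2 (hu ⟨k, hk, rfl⟩)

theorem isAdapted_iff_of_mem_iff (h : ∀ j i, v j ∈ Y i ↔ u j ∈ X i) :
    IsAdapted Y v ↔ IsAdapted X u := by
  simp only [IsAdapted, seqPrefix_subset_iff_of_mem_iff h, h]

/-- Both sequences of prefix ranks satisfy the same inequalities `≤ i`, for all `i ≤ r`, and neither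
exceeds `r`. -/
theorem seqRanks_eq_of_mem_iff (hX : X ∈ M.flatChains r M.E) (hY : Y ∈ N.flatChains r N.E)
    (hu : ∀ j, u j ∈ M.E) (hv : ∀ j, v j ∈ N.E) (h : ∀ j i, v j ∈ Y i ↔ u j ∈ X i)
    (hXu : IsAdapted X u) : N.seqRanks v = M.seqRanks u := by
  have hYv := (isAdapted_iff_of_mem_iff h).2 hXu
  have hle : ∀ j (i : Fin (r + 1)), N.natRk (seqPrefix v j) ≤ i ↔ M.natRk (seqPrefix u j) ≤ i := by
    intro j i
    rw [← hXu.seqPrefix_subset_iff hX hu, ← hYv.seqPrefix_subset_iff hY hv,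
      seqPrefix_subset_iff_of_mem_iff h]
  have hM : ∀ j, M.natRk (seqPrefix u j) < r + 1 := by
    intro j
    refine Nat.lt_succ_of_le ((hXu.seqPrefix_subset_iff hX hu j (Fin.last r)).1 ?_)
    rw [hX.2.2]
    rintro _ ⟨k, -, rfl⟩
    exact hu k
  have hN : ∀ j, N.natRk (seqPrefix v j) < r + 1 := fun j =>
    Nat.lt_succ_of_le ((hle j (Fin.last r)).2 (Nat.le_of_lt_succ (hM j)))
  have heq : ∀ j, N.natRk (seqPrefix v j) = M.natRk (seqPrefix u j) := fun j =>
    le_antisymm ((hle j ⟨_, hM j⟩).2 le_rfl) ((hle j ⟨_, hN j⟩).1 le_rfl)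
  simp only [seqRanks, heq]

theorem exists_orderings_equiv (hM : M.natRank = r) (hN : N.natRank = r)
    (φ : M.flatChains r M.E ≃ N.flatChains r N.E) (hφ : ∀ X, flagComp (φ X).1 = flagComp X.1) :
    ∃ Ψ : (Fin n ≃ M.E) ≃ (Fin n ≃ N.E),
      ∀ π, N.seqRanks (fun j => (Ψ π j : β)) = M.seqRanks (fun j => (π j : α)) := by
  have hrange : ∀ π : Fin n ≃ M.E, Set.range (fun j => (π j : α)) = M.E := fun π => by
    rw [← Function.comp_def Subtype.val π, π.surjective.range_comp, Subtype.range_val]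
  have hrange' : ∀ π : Fin n ≃ N.E, Set.range (fun j => (π j : β)) = N.E := fun π => by
    rw [← Function.comp_def Subtype.val π, π.surjective.range_comp, Subtype.range_val]
  have hex : ∀ π : Fin n ≃ M.E, ∃ X : M.flatChains r M.E, IsAdapted X.1 fun j => (π j : α) :=
    fun π => let ⟨X, hX, h⟩ := exists_isAdapted hM (hrange π); ⟨⟨X, hX⟩, h⟩
  have hex' : ∀ π : Fin n ≃ N.E, ∃ X : N.flatChains r N.E, IsAdapted X.1 fun j => (π j : β) :=
    fun π => let ⟨X, hX, h⟩ := exists_isAdapted hN (hrange' π); ⟨⟨X, hX⟩, h⟩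
  choose c hc using hex
  choose c' hc' using hex'
  have hciff : ∀ π (X : M.flatChains r M.E), c π = X ↔ IsAdapted X.1 fun j => (π j : α) :=
    fun π X => ⟨fun h => h ▸ hc π, fun h => Subtype.ext ((hc π).eq h (c π).2 X.2 (hrange π))⟩
  have hciff' : ∀ π (X : N.flatChains r N.E), c' π = X ↔ IsAdapted X.1 fun j => (π j : β) :=
    fun π X => ⟨fun h => h ▸ hc' π, fun h => Subtype.ext ((hc' π).eq h (c' π).2 X.2 (hrange' π))⟩
  have := M.ground_finite.to_subtype
  have := N.ground_finite.to_subtype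
  -- Orderings are sorted by flag and rank sequence. Composition with a ground-set bijection `g`
  -- carrying `X` to `φ X` matches the fibres; `g` may vary with the flag.
  obtain ⟨Ψ, hΨ⟩ := exists_equiv_of_card_fiber_eq
    (fun π : Fin n ≃ M.E => (φ (c π), M.seqRanks fun j => (π j : α)))
    (fun π : Fin n ≃ N.E => (c' π, N.seqRanks fun j => (π j : β))) <| by
      rintro ⟨Y, w⟩
      obtain ⟨X, rfl⟩ := φ.surjective Y
      obtain ⟨g, hg⟩ := exists_equiv_ground_of_flagComp_eq X.2 (φ X).2 (hφ X).symm
      refine Nat.card_congr ((Equiv.equivCongr (Equiv.refl (Fin n)) g).subtypeEquiv fun π => ?_)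
      have hmem : ∀ j i, ((g (π j) : N.E) : β) ∈ (φ X).1 i ↔ (π j : α) ∈ X.1 i :=
        fun j i => hg (π j) i
      change (_, _) = (_, _) ↔ (_, _) = (_, _)
      rw [Prod.mk.injEq, Prod.mk.injEq, φ.injective.eq_iff, hciff, hciff']
      change _ ↔ IsAdapted (φ X).1 (fun j => (g (π j) : β)) ∧
        N.seqRanks (fun j => (g (π j) : β)) = w
      rw [isAdapted_iff_of_mem_iff hmem]
      refine and_congr_right fun hX => ?_
      rw [seqRanks_eq_of_mem_iff X.2 (φ X).2 (fun j => (π j).2) (fun j => (g (π j)).2) hmem hX]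
  exact ⟨Ψ, fun π => (Prod.ext_iff.1 (hΨ π)).2⟩

omit [M.Finite] in
theorem gInvariant_eq_finsum (K : Type*) [Field K] (hn : M.E.ncard = n) :
    M.gInvariant K =
      ∑ᶠ π : Fin n ≃ M.E, Finsupp.single (M.seqRanks fun j => (π j : α)) (1 : K) := by
  subst hn
  rfl

end Transport

/-! ### Coloop-free matroids and the conclusion -/

theorem isCyclic_ground {α : Type*} {M : Matroid α} (hM : M.coloops = ∅) : M.IsCyclic M.E := by
  refine isCyclic_iff.2 fun x hx => ?_
  by_contra! h
  have : M.IsColoop x := (isColoop_iff_forall_notMem_isCircuit hx).2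
    fun C hC hxC => h C hC.subset_ground hC hxC
  exact (hM ▸ this : x ∈ (∅ : Set α))

end Matroid

open Matroid in
theorem theorem7p3 {K : Type*} [Field K] [CharZero K]
    {α : Type*} (M : Matroid α) [M.Finite] (hM : M.coloops = ∅)
    {β : Type*} (N : Matroid β) [N.Finite] (hN : N.coloops = ∅)
    {L : Type*} [Lattice L] (s ρ : L → ℕ)
    (hML : M.IsConfiguration s ρ) (hNL : N.IsConfiguration s ρ) :
    M.catenaryData = N.catenaryData ∧ M.gInvariant K = N.gInvariant K := by
  obtain ⟨e, he⟩ := hML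
  obtain ⟨f, hf⟩ := hNL
  have htype : flatType e ⟨M.E, M.ground_isFlat⟩ = flatType f ⟨N.E, N.ground_isFlat⟩ := by
    have h1 : M.cyclicPart M.E = M.E := (isCyclic_ground hM).cyclicPart_eq
    have h2 : N.cyclicPart N.E = N.E := (isCyclic_ground hN).cyclicPart_eq
    -- In each matroid every cyclic flat lies in the ground set, so each of the two first components
    -- bounds the other.
    refine Prod.ext (le_antisymm ?_ ?_) ?_
    · refine (subset_iff_le_flatType _).1 ?_
      exact (f _).2.1.subset_ground
    · refine (subset_iff_le_flatType _).1 ?_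
      exact (e _).2.1.subset_ground
    · simp [flatType, h1, h2]
  have hrank : M.natRank = N.natRank := by
    change M.natRk M.E = N.natRk N.E
    rw [natRk_eq_flatType (F := ⟨M.E, M.ground_isFlat⟩) he,
      natRk_eq_flatType (F := ⟨N.E, N.ground_isFlat⟩) hf, htype]
  have hcard : M.E.ncard = N.E.ncard := by
    rw [ncard_eq_flatType (F := ⟨M.E, M.ground_isFlat⟩) he,
      ncard_eq_flatType (F := ⟨N.E, N.ground_isFlat⟩) hf, htype]
  obtain ⟨φ, hφ⟩ := exists_flatChains_equiv he hf N.natRank htype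
  constructor
  · funext a
    rw [catenaryData_eq_ncard hrank, catenaryData_eq_ncard rfl]
    refine Nat.card_congr ((Equiv.subtypeSubtypeEquivSubtypeInter (· ∈ M.flatChains N.natRank M.E)
      fun X => flagComp X = a).symm.trans ((φ.subtypeEquiv fun X => ?_).trans
      (Equiv.subtypeSubtypeEquivSubtypeInter (· ∈ N.flatChains N.natRank N.E)
        fun X => flagComp X = a)))
    rw [hφ]
  · obtain ⟨Ψ, hΨ⟩ := exists_orderings_equiv (n := N.E.ncard) hrank rfl φ hφ
    rw [gInvariant_eq_finsum K hcard, gInvariant_eq_finsum K rfl]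
    exact finsum_eq_of_bijective Ψ Ψ.bijective fun π => by rw [hΨ]
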